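/- Let $M$ be a smooth $n$-dimensional manifold, $p\ge 1$ an integer, $\Pi$ a smooth bivector field, $R$ a smooth $(p+1)$-vector field and $H$ a smooth closed $(p+2)$-form on $M$. In local coordinates $(x^i)$ write $\Pi=\frac12\Pi^{ij}\partial_i\wedge\partial_j$, $R=\frac1{(p+1)!}R^{k_1\dots k_{p+1}}\partial_{k_1}\wedge\dots\wedge\partial_{k_{p+1}}$, $H=\frac1{(p+2)!}H_{l_1\dots l_{p+2}}dx^{l_1}\wedge\dots\wedge dx^{l_{p+2}}$ (sums over repeated indices are understood). On the graded manifold $T^*[p]T^*[1]M$ (a supermanifold whose algebra of functions carries an additional $\mathbb Z$-grading), with local coordinates $(x^i,a_i,y^i,z_i)$ of degrees $(0,1,p-1,p)$ over each chart of $M$, the parity of a coordinate being that of its degree, consider the vector field given in each of these coordinate systems by $$\begin{aligned}Q={}&\Pi^{ji}a_j\,\partial_{x^i}-\tfrac12\,\partial_i\Pi^{jk}a_ja_k\,\partial_{a_i}+\Big((-1)^p\Pi^{ji}z_j-\partial_j\Pi^{ik}a_ky^j+\tfrac1{p!}R^{ij_1\dots j_p}a_{j_1}\cdots a_{j_p}\Big)\partial_{y^i}\\&+\Big(\partial_i\Pi^{jk}a_kz_j-\tfrac{(-1)^p}2\,\partial_i\partial_j\Pi^{kl}y^ja_ka_l+\tfrac{(-1)^p}{(p+1)!}f_i^{k_1\dots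 k_{p+1}}a_{k_1}\cdots a_{k_{p+1}}\Big)\partial_{z_i},\end{aligned}$$ $$f_i^{k_1\dots k_{p+1}}=\partial_iR^{k_1\dots k_{p+1}}+\Pi^{k_1l_1}\cdots\Pi^{k_{p+1}l_{p+1}}H_{il_1\dots l_{p+1}}.$$ Then $(T^*[p]T^*[1]M,Q)$ is a $Q$-manifold (in the coordinates over every chart of $M$, $Q$ is an odd derivation of degree $1$ with $Q^2=0$) if and only if $(M,\Pi,R,H)$ is a twisted $R$-Poisson manifold of order $p+1$, that is, $dH=0$, $$[\Pi,\Pi]=0\qquad\text{and}\qquad[\Pi,R]=(-1)^{p+1}\langle\otimes^{p+2}\Pi,H\rangle .$$ Here $\langle\otimes^{p+2}\Pi,H\rangle$ is the $(p+2)$-vector field with components $\Pi^{l_1k_1}\cdots\Pi^{l_{p+2}k_{p+2}}H_{l_1\dots l_{p+2}}$, and $[\cdot,\cdot]$ is the Schouten–Nijenhuis bracket, with the sign convention $$[v_1\wedge\dots\wedge v_a,\,w_1\wedge\dots\wedge w_b]=\sum_{i,j}(-1)^{i+j}[v_i,w_j]\wedge v_1\wedge\dots\widehat{v_i}\dots\wedge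 v_a\wedge w_1\wedge\dots\widehat{w_j}\dots\wedge w_b$$ for vector fields $v_i,w_j$. -/

import Mathlib

open scoped Manifold ContDiff TensorProduct
open TopologicalSpace

noncomputable section

namespace RPoisson

/-! ### Multivector fields and differential forms on a smooth manifold -/

/-- The model space `ℝⁿ`. -/
abbrev E (n : ℕ) : Type := EuclideanSpace ℝ (Fin n)

/-- The partial derivative `∂g/∂xⁱ` at `u ∈ ℝⁿ`. -/
def pd {n : ℕ} (i : Fin n) (g : E n → ℝ) (u : E n) : ℝ :=
  fderiv ℝ g u (EuclideanSpace.single i 1)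

section Manifold

variable {n : ℕ} {M : Type*} [TopologicalSpace M] [ChartedSpace (E n) M]

/-- The differential `dxⁱ` at the point `m` of the `i`-th coordinate function of the chart `e`. -/
def dcoord (e : OpenPartialHomeomorph M (E n)) (i : Fin n) (m : M) :
    TangentSpace (𝓡 n) m →L[ℝ] ℝ :=
  (EuclideanSpace.proj i : E n →L[ℝ] ℝ).comp (mfderiv (𝓡 n) (𝓡 n) e m)

/-- The components `T^{k₁…k_q} = T(dx^{k₁}, …, dx^{k_q})`, in the chart `e` and as functions of the
coordinates `u`, of a field of alternating `q`-linear forms on the cotangent spaces. -/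
def upperComp {q : ℕ} (T : (m : M) → (TangentSpace (𝓡 n) m →L[ℝ] ℝ) [⋀^Fin q]→L[ℝ] ℝ)
    (e : OpenPartialHomeomorph M (E n)) (K : Fin q → Fin n) (u : E n) : ℝ :=
  T (e.symm u) fun r => dcoord e (K r) (e.symm u)

/-- The expression in the chart `e` (that is, the pullback by `e⁻¹`) of a field of alternating
`q`-linear forms on the tangent spaces. -/
def formInChart {q : ℕ} (η : (m : M) → TangentSpace (𝓡 n) m [⋀^Fin q]→L[ℝ] ℝ)
    (e : OpenPartialHomeomorph M (E n)) (u : E n) : E n [⋀^Fin q]→L[ℝ] ℝ :=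
  (η (e.symm u)).compContinuousLinearMap (mfderiv (𝓡 n) (𝓡 n) e.symm u)

variable (n M)

/-- A smooth `q`-vector field, i.e. a smooth section of `⋀^q TM`, seen as a field of alternating
`q`-linear forms on the cotangent spaces. With `T = (1/q!) T^{k₁…k_q} ∂_{k₁} ∧ … ∧ ∂_{k_q}` in
coordinates, the functions `T^{k₁…k_q}` are the components `upperComp`. -/
structure MultivectorField (q : ℕ) where
  toFun : (m : M) → (TangentSpace (𝓡 n) m →L[ℝ] ℝ) [⋀^Fin q]→L[ℝ] ℝ
  smooth : ∀ e ∈ IsManifold.maximalAtlas (𝓡 n) ∞ M, ∀ K : Fin q → Fin n,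
    ContDiffOn ℝ ∞ (upperComp toFun e K) e.target

/-- A smooth differential `q`-form. -/
structure FormField (q : ℕ) where
  toFun : (m : M) → TangentSpace (𝓡 n) m [⋀^Fin q]→L[ℝ] ℝ
  smooth : ∀ e ∈ IsManifold.maximalAtlas (𝓡 n) ∞ M,
    ContDiffOn ℝ ∞ (formInChart toFun e) e.target

variable {n M}

/-- The components `T^{k₁…k_q}` of a multivector field in a chart. -/
def MultivectorField.comp {q : ℕ} (T : MultivectorField n M q)
    (e : OpenPartialHomeomorph M (E n)) (K : Fin q → Fin n) (u : E n) : ℝ :=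
  upperComp T.toFun e K u

/-- The components `η_{l₁…l_q} = η(∂_{l₁}, …, ∂_{l_q})` of a differential form in a chart. -/
def FormField.comp {q : ℕ} (η : FormField n M q)
    (e : OpenPartialHomeomorph M (E n)) (L : Fin q → Fin n) (u : E n) : ℝ :=
  formInChart η.toFun e u fun r => EuclideanSpace.single (L r) 1

/-- `dη = 0`. -/
def FormField.IsClosed {q : ℕ} (η : FormField n M q) : Prop :=
  ∀ e ∈ IsManifold.maximalAtlas (𝓡 n) ∞ M, ∀ u ∈ e.target, extDeriv (formInChart η.toFun e) u = 0

/-- The component `[P, T]^{k₁…k_{q+2}}` of the Schouten–Nijenhuis bracket of a bivector field `P`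
and a `(q+1)`-vector field `T`, in a chart: the total antisymmetrization of
`(1/(q+1)!) P^{k₁ i} ∂ᵢ T^{k₂…k_{q+2}} - (1/(2 q!)) T^{i k₁…k_q} ∂ᵢ P^{k_{q+1} k_{q+2}}`.
This is the bracket that extends the Lie bracket of vector fields by
`[v₁ ∧ … ∧ v_a, w₁ ∧ … ∧ w_b] = ∑_{i,j} (-1)^{i+j} [vᵢ, wⱼ] ∧ v₁ ∧ … v̂ᵢ … ∧ v_a ∧ w₁ ∧ … ŵⱼ … ∧ w_b`. -/
def schouten {q : ℕ} (P : MultivectorField n M 2) (T : MultivectorField n M (q + 1))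
    (e : OpenPartialHomeomorph M (E n)) (K : Fin (q + 2) → Fin n) (u : E n) : ℝ :=
  ∑ σ : Equiv.Perm (Fin (q + 2)), ((Equiv.Perm.sign σ : ℤ) : ℝ) *
    (1 / ((q + 1).factorial : ℝ) *
        ∑ i : Fin n, P.comp e ![K (σ 0), i] u *
          pd i (T.comp e fun r : Fin (q + 1) => K (σ r.succ)) u
      - 1 / (2 * (q.factorial : ℝ)) *
        ∑ i : Fin n, T.comp e (Fin.cons i fun r : Fin q => K (σ (Fin.castAdd 2 r))) u *
          pd i (P.comp e ![K (σ (Fin.natAdd q 0)), K (σ (Fin.natAdd q 1))]) u)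

/-- The component `⟨⊗^q P, η⟩^{k₁…k_q} = P^{l₁k₁} ⋯ P^{l_q k_q} η_{l₁…l_q}` in a chart: the form is
contracted with the odd-numbered indices (the first, third, fifth, …) of `⊗^q P`. -/
def contraction {q : ℕ} (P : MultivectorField n M 2) (η : FormField n M q)
    (e : OpenPartialHomeomorph M (E n)) (K : Fin q → Fin n) (u : E n) : ℝ :=
  ∑ L : Fin q → Fin n, (∏ r, P.comp e ![L r, K r] u) * η.comp e L u

/-- `(M, P, R, H)` is a twisted `R`-Poisson manifold of order `p + 1`: the bivector field `P` is
Poisson, the `(p+2)`-form `H` is closed and `[P, R] = (-1)^(p+1) ⟨⊗^(p+2) P, H⟩`. -/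
structure IsTwistedRPoisson {p : ℕ} (P : MultivectorField n M 2) (R : MultivectorField n M (p + 1))
    (H : FormField n M (p + 2)) : Prop where
  poisson : ∀ e ∈ IsManifold.maximalAtlas (𝓡 n) ∞ M, ∀ u ∈ e.target, ∀ K : Fin 3 → Fin n,
    schouten (q := 1) P P e K u = 0
  closed : H.IsClosed
  bracket : ∀ e ∈ IsManifold.maximalAtlas (𝓡 n) ∞ M, ∀ u ∈ e.target, ∀ K : Fin (p + 2) → Fin n,
    schouten P R e K u = (-1) ^ (p + 1) * contraction P H e K u

end Manifold

/-! ### The graded manifold `T*[p]T*[1]U` over a coordinate domain `U ⊆ ℝⁿ`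

It has the coordinates `xⁱ, aᵢ, yⁱ, zᵢ` of degrees `0, 1, p - 1, p`, and the parity of a coordinate
is the parity of its degree. So the `aᵢ` are odd, and exactly one of the families `y`, `z` is even:
`y` if `p` is odd and `z` if `p` is even. As a supermanifold it is `U × ℝⁿ`, where the coordinates
of the factor `ℝⁿ` are those of the even one of the two families, with `2n` odd coordinates, namely
the `aᵢ` (left summand below) and the odd one of the two families (right summand). -/

section Superdomain

variable {n : ℕ}

/-- The body `U × ℝⁿ`. -/
def body (U : Opens (E n)) : Opens (E n × E n) :=
  ⟨(U : Set (E n)) ×ˢ Set.univ, U.isOpen.prod isOpen_univ⟩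

/-- Smooth functions on the body. -/
abbrev BodyFun (U : Opens (E n)) : Type := C^∞⟮𝓘(ℝ, E n × E n), body U; ℝ⟯

/-- The Grassmann algebra on the `2n` odd coordinates. -/
abbrev Grassmann (n : ℕ) : Type := ExteriorAlgebra ℝ (Fin n ⊕ Fin n → ℝ)

/-- The superalgebra of functions `C^∞(U × ℝⁿ) ⊗ ⋀(ℝⁿ ⊕ ℝⁿ)`. -/
abbrev SuperFun (U : Opens (E n)) : Type := BodyFun U ⊗[ℝ] Grassmann n

/-- The extension by zero of a function on the body to the ambient vector space. -/
def extend {U : Opens (E n)} (f : body U → ℝ) : E n × E n → ℝ := Function.extend Subtype.val f 0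

lemma extend_apply {U : Opens (E n)} (f : body U → ℝ) (w : body U) : extend f w = f w :=
  Subtype.val_injective.extend_apply f 0 w

lemma contDiffAt_extend {U : Opens (E n)} (f : BodyFun U) (w : body U) :
    ContDiffAt ℝ ∞ (extend f) (w : E n × E n) := by
  rw [← contMDiffAt_iff_contDiffAt, ← contMDiffAt_subtype_iff]
  simpa only [extend_apply] using f.contMDiff w

/-- A function on the body that is the restriction of a function which is smooth on the body. -/
def ofContDiffAt {U : Opens (E n)} (g : E n × E n → ℝ)
    (hg : ∀ w : body U, ContDiffAt ℝ ∞ g (w : E n × E n)) : BodyFun U :=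
  ⟨fun w => g w, fun w => contMDiffAt_subtype_iff.2 (contMDiffAt_iff_contDiffAt.2 (hg w))⟩

lemma contDiffAt_dirDeriv {U : Opens (E n)} (v : E n × E n) (f : BodyFun U) (w : body U) :
    ContDiffAt ℝ ∞ (fun w : E n × E n => fderiv ℝ (extend f) w v) (w : E n × E n) :=
  ((contDiffAt_extend f w).fderiv_right (m := ∞) le_rfl).clm_apply contDiffAt_const

/-- The derivative of smooth functions on the body in the constant direction `v`. -/
def dirDeriv {U : Opens (E n)} (v : E n × E n) : BodyFun U →ₗ[ℝ] BodyFun U where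
  toFun f := ofContDiffAt (fun w => fderiv ℝ (extend f) w v) (contDiffAt_dirDeriv v f)
  map_add' f g := by
    ext w
    have h : extend (⇑(f + g) : body U → ℝ) = extend f + extend g := by
      ext x
      rcases em (∃ w : body U, (w : E n × E n) = x) with ⟨w, rfl⟩ | hx
      · simp [extend_apply]
      · simp [extend, Function.extend_apply' _ _ _ hx]
    change fderiv ℝ (extend ⇑(f + g)) w v = fderiv ℝ (extend f) w v + fderiv ℝ (extend g) w v
    rw [h, fderiv_add ((contDiffAt_extend f w).differentiableAt (by simp))
      ((contDiffAt_extend g w).differentiableAt (by simp))]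
    rfl
  map_smul' c f := by
    ext w
    have h : extend (⇑(c • f) : body U → ℝ) = c • extend f := by
      ext x
      rcases em (∃ w : body U, (w : E n × E n) = x) with ⟨w, rfl⟩ | hx
      · simp [extend_apply]
      · simp [extend, Function.extend_apply' _ _ _ hx]
    change fderiv ℝ (extend ⇑(c • f)) w v = c • fderiv ℝ (extend f) w v
    rw [h, fderiv_const_smul ((contDiffAt_extend f w).differentiableAt (by simp))]
    rfl

lemma contDiffAt_base {U : Opens (E n)} {g : E n → ℝ} (hg : ContDiffOn ℝ ∞ g (U : Set (E n)))
    (w : body U) : ContDiffAt ℝ ∞ (fun w : E n × E n => g w.1) (w : E n × E n) :=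
  ContDiffAt.comp (w : E n × E n) (hg.contDiffAt (U.isOpen.mem_nhds w.2.1)) contDiffAt_fst

lemma contDiffAt_fibre {U : Opens (E n)} (i : Fin n) (w : body U) :
    ContDiffAt ℝ ∞ (fun w : E n × E n => w.2 i) (w : E n × E n) :=
  (EuclideanSpace.proj i : E n →L[ℝ] ℝ).contDiff.contDiffAt.comp _ contDiffAt_snd

/-- A smooth function of the coordinates `xⁱ` on `U`, as a function on the body. -/
def ofBase {U : Opens (E n)} (g : E n → ℝ) (hg : ContDiffOn ℝ ∞ g (U : Set (E n))) : BodyFun U :=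
  ofContDiffAt (fun w => g w.1) (contDiffAt_base hg)

/-- A body function as a superfunction. -/
def ofBody {U : Opens (E n)} (f : BodyFun U) : SuperFun U := f ⊗ₜ[ℝ] 1

/-- The even coordinates on the fibre. -/
def evenCoord {U : Opens (E n)} (i : Fin n) : SuperFun U :=
  ofBody (ofContDiffAt (fun w => w.2 i) (contDiffAt_fibre i))

/-- The odd coordinates. -/
def oddCoord {U : Opens (E n)} (j : Fin n ⊕ Fin n) : SuperFun U :=
  (1 : BodyFun U) ⊗ₜ[ℝ] ExteriorAlgebra.ι ℝ (Pi.single j 1)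

/-- The partial derivative `∂/∂xⁱ` on superfunctions. -/
def dX {U : Opens (E n)} (i : Fin n) : SuperFun U →ₗ[ℝ] SuperFun U :=
  LinearMap.rTensor (Grassmann n) (dirDeriv (EuclideanSpace.single i 1, 0))

/-- The partial derivative with respect to an even coordinate on the fibre. -/
def dEven {U : Opens (E n)} (i : Fin n) : SuperFun U →ₗ[ℝ] SuperFun U :=
  LinearMap.rTensor (Grassmann n) (dirDeriv (0, EuclideanSpace.single i 1))

/-- The (left) partial derivative with respect to an odd coordinate: the interior product of the
Grassmann algebra with the dual basis vector. -/
def dOdd {U : Opens (E n)} (j : Fin n ⊕ Fin n) : SuperFun U →ₗ[ℝ] SuperFun U :=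
  LinearMap.lTensor (BodyFun U)
    (CliffordAlgebra.contractLeft (LinearMap.proj j : (Fin n ⊕ Fin n → ℝ) →ₗ[ℝ] ℝ))

/-- The parity involution: `f` on even and `-f` on odd superfunctions. -/
def parity {U : Opens (E n)} : SuperFun U →ₗ[ℝ] SuperFun U :=
  LinearMap.lTensor (BodyFun U)
    (CliffordAlgebra.involute (Q := (0 : QuadraticForm ℝ (Fin n ⊕ Fin n → ℝ)))).toLinearMap

/-- The coordinates `aᵢ`, of degree `1`. -/
def ca {U : Opens (E n)} (i : Fin n) : SuperFun U := oddCoord (Sum.inl i)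

/-- The coordinates `yⁱ`, of degree `p - 1`. -/
def cy {U : Opens (E n)} (p : ℕ) (i : Fin n) : SuperFun U :=
  if Even p then oddCoord (Sum.inr i) else evenCoord i

/-- The coordinates `zᵢ`, of degree `p`. -/
def cz {U : Opens (E n)} (p : ℕ) (i : Fin n) : SuperFun U :=
  if Even p then evenCoord i else oddCoord (Sum.inr i)

/-- `∂/∂aᵢ`. -/
def dA {U : Opens (E n)} (i : Fin n) : SuperFun U →ₗ[ℝ] SuperFun U := dOdd (Sum.inl i)

/-- `∂/∂yⁱ`. -/
def dY {U : Opens (E n)} (p : ℕ) (i : Fin n) : SuperFun U →ₗ[ℝ] SuperFun U :=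
  if Even p then dOdd (Sum.inr i) else dEven i

/-- `∂/∂zᵢ`. -/
def dZ {U : Opens (E n)} (p : ℕ) (i : Fin n) : SuperFun U →ₗ[ℝ] SuperFun U :=
  if Even p then dEven i else dOdd (Sum.inr i)

/-- The product `a_{k₁} ⋯ a_{k_q}`. -/
def caProd {U : Opens (E n)} {q : ℕ} (K : Fin q → Fin n) : SuperFun U :=
  (List.ofFn fun r => ca (K r)).prod

/-- The Euler vector field, whose eigenfunctions with eigenvalue `d` are the functions of
degree `d`. -/
def euler {U : Opens (E n)} (p : ℕ) : SuperFun U →ₗ[ℝ] SuperFun U :=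
  ∑ i, (LinearMap.mulLeft ℝ (ca i) ∘ₗ dA i
    + ((p : ℝ) - 1) • (LinearMap.mulLeft ℝ (cy p i) ∘ₗ dY p i)
    + (p : ℝ) • (LinearMap.mulLeft ℝ (cz p i) ∘ₗ dZ p i))

/-- `f` is a function of degree `d` on `T*[p]T*[1]U`. -/
def HasDegree {U : Opens (E n)} (p : ℕ) (d : ℤ) (f : SuperFun U) : Prop :=
  euler p f = (d : ℝ) • f

/-- `Q` is a homological vector field on `T*[p]T*[1]U`: an odd derivation of the superalgebra of
functions which raises the degree by `1` and squares to zero. -/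
structure IsHomological {U : Opens (E n)} (p : ℕ) (Q : SuperFun U →ₗ[ℝ] SuperFun U) : Prop where
  leibniz : ∀ f g : SuperFun U, Q (f * g) = Q f * g + parity f * Q g
  degree_one : ∀ (d : ℤ) (f : SuperFun U), HasDegree p d f → HasDegree p (d + 1) (Q f)
  sq_zero : ∀ f : SuperFun U, Q (Q f) = 0

/-! ### The vector field `Q` -/

section VectorField

variable {U : Opens (E n)} {p : ℕ}
  (P : (Fin 2 → Fin n) → BodyFun U) (R : (Fin (p + 1) → Fin n) → BodyFun U)
  (H : (Fin (p + 2) → Fin n) → BodyFun U)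

/-- `∂/∂xⁱ` on functions on the body. -/
def bX (i : Fin n) : BodyFun U →ₗ[ℝ] BodyFun U := dirDeriv (EuclideanSpace.single i 1, 0)

/-- `fᵢ^{k₁…k_{p+1}} = ∂ᵢ R^{k₁…k_{p+1}} + P^{k₁l₁} ⋯ P^{k_{p+1}l_{p+1}} H_{i l₁…l_{p+1}}`. -/
def fCoeff (i : Fin n) (K : Fin (p + 1) → Fin n) : BodyFun U :=
  bX i (R K) + ∑ L : Fin (p + 1) → Fin n, (∏ r, P ![K r, L r]) * H (Fin.cons i L)

/-- `Q xⁱ = P^{ji} aⱼ`. -/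
def Qx (i : Fin n) : SuperFun U := ∑ j, ofBody (P ![j, i]) * ca j

/-- `Q aᵢ = -(1/2) ∂ᵢP^{jk} aⱼ aₖ`. -/
def Qa (i : Fin n) : SuperFun U :=
  -(1 / 2 : ℝ) • ∑ j, ∑ k, ofBody (bX i (P ![j, k])) * ca j * ca k

/-- `Q yⁱ = (-1)^p P^{ji} zⱼ - ∂ⱼP^{ik} aₖ yʲ + (1/p!) R^{i j₁…j_p} a_{j₁} ⋯ a_{j_p}`. -/
def Qy (i : Fin n) : SuperFun U :=
  (-1 : ℝ) ^ p • ∑ j, ofBody (P ![j, i]) * cz p j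
    - ∑ j, ∑ k, ofBody (bX j (P ![i, k])) * ca k * cy p j
    + (1 / (p.factorial : ℝ)) •
        ∑ J : Fin p → Fin n, ofBody (R (Fin.cons i J)) * caProd J

/-- `Q zᵢ = ∂ᵢP^{jk} aₖ zⱼ - ((-1)^p/2) ∂ᵢ∂ⱼP^{kl} yʲ aₖ aₗ
  + ((-1)^p/(p+1)!) fᵢ^{k₁…k_{p+1}} a_{k₁} ⋯ a_{k_{p+1}}`. -/
def Qz (i : Fin n) : SuperFun U :=
  ∑ j, ∑ k, ofBody (bX i (P ![j, k])) * ca k * cz p j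
    - ((-1 : ℝ) ^ p / 2) •
        ∑ j, ∑ k, ∑ l, ofBody (bX i (bX j (P ![k, l]))) * cy p j * ca k * ca l
    + ((-1 : ℝ) ^ p / ((p + 1).factorial : ℝ)) •
        ∑ K : Fin (p + 1) → Fin n, ofBody (fCoeff P R H i K) * caProd K

/-- The vector field `Q = (Q xⁱ) ∂/∂xⁱ + (Q aᵢ) ∂/∂aᵢ + (Q yⁱ) ∂/∂yⁱ + (Q zᵢ) ∂/∂zᵢ`. -/
def QField : SuperFun U →ₗ[ℝ] SuperFun U :=
  ∑ i, (LinearMap.mulLeft ℝ (Qx P i) ∘ₗ dX i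
    + LinearMap.mulLeft ℝ (Qa P i) ∘ₗ dA i
    + LinearMap.mulLeft ℝ (Qy P R i) ∘ₗ dY p i
    + LinearMap.mulLeft ℝ (Qz P R H i) ∘ₗ dZ p i)

end VectorField

end Superdomain

section Global

variable {n : ℕ} {M : Type*} [TopologicalSpace M] [ChartedSpace (E n) M]

/-- The coordinate domain of a chart. -/
def dom (e : OpenPartialHomeomorph M (E n)) : Opens (E n) := ⟨e.target, e.open_target⟩

/-- The components of a multivector field in a chart, as functions on the body. -/
def MultivectorField.coeff {q : ℕ} (T : MultivectorField n M q)
    {e : OpenPartialHomeomorph M (E n)} (he : e ∈ IsManifold.maximalAtlas (𝓡 n) ∞ M)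
    (K : Fin q → Fin n) : BodyFun (dom e) :=
  ofBase (T.comp e K) (T.smooth e he K)

lemma FormField.contDiffOn_comp {q : ℕ} (η : FormField n M q)
    {e : OpenPartialHomeomorph M (E n)} (he : e ∈ IsManifold.maximalAtlas (𝓡 n) ∞ M)
    (L : Fin q → Fin n) : ContDiffOn ℝ ∞ (η.comp e L) e.target :=
  (ContinuousAlternatingMap.apply ℝ (E n) ℝ
    (fun r => EuclideanSpace.single (L r) (1 : ℝ))).contDiff.comp_contDiffOn (η.smooth e he)

/-- The components of a differential form in a chart, as functions on the body. -/
def FormField.coeff {q : ℕ} (η : FormField n M q)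
    {e : OpenPartialHomeomorph M (E n)} (he : e ∈ IsManifold.maximalAtlas (𝓡 n) ∞ M)
    (L : Fin q → Fin n) : BodyFun (dom e) :=
  ofBase (η.comp e L) (η.contDiffOn_comp he L)

/-- `(T*[p]T*[1]M, Q)` is a `Q`-manifold: in the graded coordinates `(x, a, y, z)` over every
coordinate chart of `M`, the vector field `Q` built from the components of `P`, `R`, `H` in that
chart is homological. In a change of chart `x ↦ x'` of `M` these graded coordinates transform as
`aᵢ = (∂x'ʲ/∂xⁱ) a'ⱼ`, `y'ⁱ = (∂x'ⁱ/∂xʲ) yʲ`,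
`zᵢ = (∂x'ʲ/∂xⁱ) z'ⱼ - (∂²x'ᵏ/∂xⁱ∂xʲ) yʲ a'ₖ`, and the local vector fields `Q` agree; the conditions
on `Q` are local, so that they can be tested in the coordinates of each chart. -/
def IsQManifold {p : ℕ} (P : MultivectorField n M 2) (R : MultivectorField n M (p + 1))
    (H : FormField n M (p + 2)) : Prop :=
  ∀ (e : OpenPartialHomeomorph M (E n)) (he : e ∈ IsManifold.maximalAtlas (𝓡 n) ∞ M),
    IsHomological p (QField (P.coeff he) (R.coeff he) (H.coeff he))

end Global

end RPoisson

end

/-! Everything is checked in one chart. Write π = ½ Pʲᵏ aⱼ aₖ and ρ for the polynomial in a with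
components R. Then Q xⁱ = -∂π/∂aᵢ and Q aᵢ = -∂π/∂xⁱ, so on functions of x and a alone Q is the
Hamiltonian vector field of π for the odd Poisson bracket of T*[1]M. Such functions are multivector
fields and that bracket is the Schouten bracket: Q sends T to [P, T] (`Frame.Q_mv`). The
coefficients of Q along y and z are the x- and a-derivatives of Q x and Q a paired with z and y,
plus derivatives of ρ and a term twist_i containing H (`Frame.qy_eq`, `Frame.qz_eq`).

The square of an odd vector field has no second-order part, since partial derivatives supercommute
(`vf_vf`). So Q² = 0 can be tested on coordinates. There Q² xʲ = ½ ∂(Qπ)/∂aⱼ and Q² aⱼ = -½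
∂(Qπ)/∂xʲ (`Frame.Q_qx`, `Frame.Q_qa`), and, once these vanish, Q² yⁱ = -∂(Qρ + τ)/∂aᵢ and Q² zᵢ =
(-1)^p ∂(Qρ + τ)/∂xⁱ (`Frame.Q_qy`, `Frame.Q_qz`), where τ is H with every dxˡ replaced by Q xˡ, up
to the sign (-1)^(p+2) the multivector ⟨⊗^(p+2) P, H⟩.

Hence [P, P] = 0 and [P, R] + (-1)^(p+2) ⟨⊗^(p+2) P, H⟩ = 0 imply Q² = 0. Conversely Q² = 0 on x, a,
y kills all a-derivatives of Qπ and of Qρ + τ; these have positive degree in a, and an alternating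
family is recovered from its polynomial (`Frame.mv_eq_zero`), so both vanish. Closedness of H enters
only in Q² z: with Q² x = 0, replacing dx by Q x turns d into Q, so Cartan's formula ∂ᵢH = d(ιᵢH)
becomes the formula for ∂τ/∂xⁱ in `Frame.dx_mv_contr`. The Leibniz rule and the degree hold
unconditionally (`Frame.Q_super`, `Frame.deg_Q`).

Which of y, z is even depends on the parity of p. The structure `Frame` records only the sign rules
both cases share, so that the computation is done once; y gets the parity p + 1, equal to that of p
- 1 without a subtraction of natural numbers. -/

namespace RPoisson

/-! ### Superderivations -/

section Super

variable {A : Type*} [Ring A] [Algebra ℝ A]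

/-- `c` is homogeneous of parity `k` with respect to the involution `s`, and supercommutes with
every element. -/
def IsHom (s : A →ₐ[ℝ] A) (k : ℕ) (c : A) : Prop :=
  s c = (-1 : ℝ) ^ k • c ∧ ∀ f, c * f = (s ^ k) f * c

/-- `D` is a superderivation of parity `k` with respect to the involution `s`. -/
def IsSuper (s : A →ₐ[ℝ] A) (k : ℕ) (D : A →ₗ[ℝ] A) : Prop :=
  (∀ f, s (D f) = (-1 : ℝ) ^ k • D (s f)) ∧ ∀ f g, D (f * g) = D f * g + (s ^ k) f * D g

variable {s : A →ₐ[ℝ] A}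

lemma IsHom.pow_apply {l : ℕ} {c : A} (hc : IsHom s l c) (k : ℕ) :
    (s ^ k) c = (-1 : ℝ) ^ (k * l) • c := by
  induction k with
  | zero => simp
  | succ k ih => rw [pow_succ', AlgHom.mul_apply, ih, map_smul, hc.1, smul_smul]; ring_nf

lemma IsHom.mul {k l : ℕ} {c d : A} (hc : IsHom s k c) (hd : IsHom s l d) :
    IsHom s (k + l) (c * d) := by
  refine ⟨?_, fun f => ?_⟩
  · rw [map_mul, hc.1, hd.1, smul_mul_smul_comm, pow_add]
  · rw [mul_assoc, hd.2, ← mul_assoc, hc.2, mul_assoc, pow_add, AlgHom.mul_apply]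

lemma IsHom.add {k : ℕ} {c d : A} (hc : IsHom s k c) (hd : IsHom s k d) :
    IsHom s k (c + d) :=
  ⟨by rw [map_add, hc.1, hd.1, smul_add], fun f => by rw [add_mul, mul_add, hc.2, hd.2]⟩

lemma IsHom.smul {k : ℕ} {c : A} (r : ℝ) (hc : IsHom s k c) : IsHom s k (r • c) :=
  ⟨by rw [map_smul, hc.1, smul_comm], fun f => by
    rw [smul_mul_assoc, mul_smul_comm, hc.2]⟩

lemma IsHom.zero {k : ℕ} : IsHom s k (0 : A) := ⟨by simp, by simp⟩

lemma IsHom.neg {k : ℕ} {c : A} (hc : IsHom s k c) : IsHom s k (-c) := by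
  simpa using hc.smul (-1)

lemma IsHom.sub {k : ℕ} {c d : A} (hc : IsHom s k c) (hd : IsHom s k d) :
    IsHom s k (c - d) := by
  simpa [sub_eq_add_neg] using hc.add hd.neg

lemma IsHom.sum {k : ℕ} {ι : Type*} {t : Finset ι} {c : ι → A}
    (hc : ∀ i ∈ t, IsHom s k (c i)) : IsHom s k (∑ i ∈ t, c i) :=
  Finset.sum_induction _ _ (fun _ _ => IsHom.add) IsHom.zero hc

lemma IsHom.one : IsHom s 0 (1 : A) := ⟨by simp, by simp⟩

lemma pow_add_two_mul (hs : ∀ f, s (s f) = f) (k m : ℕ) : s ^ (k + 2 * m) = s ^ k := by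
  have : s ^ 2 = 1 := by ext f; simpa [pow_two] using hs f
  rw [pow_add, pow_mul, this, one_pow, mul_one]

lemma pow_eq_mod_two (hs : ∀ f, s (s f) = f) (k : ℕ) : s ^ k = s ^ (k % 2) := by
  conv_lhs => rw [← Nat.mod_add_div k 2, pow_add_two_mul hs]

lemma IsHom.congr (hs : ∀ f, s (s f) = f) {k l : ℕ} (h : k % 2 = l % 2) {c : A}
    (hc : IsHom s k c) : IsHom s l c := by
  unfold IsHom at *
  rwa [pow_eq_mod_two hs, neg_one_pow_eq_pow_mod_two, ← h, ← pow_eq_mod_two hs,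
    ← neg_one_pow_eq_pow_mod_two]

lemma IsSuper.congr (hs : ∀ f, s (s f) = f) {k l : ℕ} (h : k % 2 = l % 2) {D : A →ₗ[ℝ] A}
    (hD : IsSuper s k D) : IsSuper s l D := by
  unfold IsSuper at *
  rwa [pow_eq_mod_two hs, neg_one_pow_eq_pow_mod_two, ← h, ← pow_eq_mod_two hs,
    ← neg_one_pow_eq_pow_mod_two]

lemma IsSuper.mulLeft {k l : ℕ} {c : A} {D : A →ₗ[ℝ] A} (hc : IsHom s k c) (hD : IsSuper s l D) :
    IsSuper s (k + l) (LinearMap.mulLeft ℝ c ∘ₗ D) := by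
  refine ⟨fun f => ?_, fun f g => ?_⟩
  · simp only [LinearMap.comp_apply, LinearMap.mulLeft_apply, map_mul, hc.1, hD.1,
      smul_mul_smul_comm, pow_add]
  · simp only [LinearMap.comp_apply, LinearMap.mulLeft_apply, hD.2, mul_add, pow_add,
      AlgHom.mul_apply]
    rw [← mul_assoc, ← mul_assoc, ← mul_assoc, hc.2 ((s ^ l) f)]

lemma IsSuper.add {k : ℕ} {D D' : A →ₗ[ℝ] A} (h : IsSuper s k D) (h' : IsSuper s k D') :
    IsSuper s k (D + D') := by
  refine ⟨fun f => ?_, fun f g => ?_⟩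
  · simp only [LinearMap.add_apply, map_add, h.1, h'.1, smul_add]
  · simp only [LinearMap.add_apply, h.2, h'.2, mul_add, add_mul]; abel

lemma IsSuper.smul {k : ℕ} {D : A →ₗ[ℝ] A} (r : ℝ) (h : IsSuper s k D) :
    IsSuper s k (r • D) := by
  refine ⟨fun f => ?_, fun f g => ?_⟩
  · rw [LinearMap.smul_apply, LinearMap.smul_apply, map_smul, h.1, smul_comm]
  · simp only [LinearMap.smul_apply, h.2, smul_add, mul_smul_comm, smul_mul_assoc]

lemma IsSuper.zero {k : ℕ} : IsSuper s k (0 : A →ₗ[ℝ] A) := ⟨by simp, by simp⟩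

lemma IsSuper.sum {k : ℕ} {ι : Type*} {t : Finset ι} {D : ι → A →ₗ[ℝ] A}
    (hc : ∀ i ∈ t, IsSuper s k (D i)) : IsSuper s k (∑ i ∈ t, D i) :=
  Finset.sum_induction _ _ (fun _ _ => IsSuper.add) IsSuper.zero hc

lemma IsSuper.map_one {k : ℕ} {D : A →ₗ[ℝ] A} (h : IsSuper s k D) : D 1 = 0 := by
  simpa using h.2 1 1

section VectorField

variable {I : Type*} [Fintype I] {k : I → ℕ} {c : I → A} {d : I → A →ₗ[ℝ] A}

/-- The vector field with coefficients `c` with respect to the partial derivatives `d`. -/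
def vf (c : I → A) (d : I → A →ₗ[ℝ] A) : A →ₗ[ℝ] A := ∑ i, LinearMap.mulLeft ℝ (c i) ∘ₗ d i

lemma vf_apply (c : I → A) (d : I → A →ₗ[ℝ] A) (f : A) : vf c d f = ∑ i, c i * d i f := by
  simp [vf, LinearMap.sum_apply]

lemma isSuper_vf (hs : ∀ f, s (s f) = f) (hc : ∀ i, IsHom s (k i + 1) (c i))
    (hd : ∀ i, IsSuper s (k i) (d i)) : IsSuper s 1 (vf c d) :=
  IsSuper.sum fun i _ => (IsSuper.mulLeft (hc i) (hd i)).congr hs (by omega)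

/-- A partial derivative commutes with an odd vector field up to the derivatives of its
coefficients. -/
lemma d_vf (hc : ∀ i, IsHom s (k i + 1) (c i))
    (hd : ∀ i, IsSuper s (k i) (d i))
    (hdd : ∀ i j f, d i (d j f) = (-1 : ℝ) ^ (k i * k j) • d j (d i f)) (j : I) (f : A) :
    d j (vf c d f) = ∑ i, d j (c i) * d i f + (-1 : ℝ) ^ k j • vf c d (d j f) := by
  simp only [vf_apply, map_sum, (hd _).2, Finset.sum_add_distrib, Finset.smul_sum]
  congr 1
  refine Finset.sum_congr rfl fun i _ => ?_
  rw [(hc i).pow_apply, hdd j i, smul_mul_smul_comm, ← pow_add,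
    show k j * (k i + 1) + k j * k i = k j + 2 * (k j * k i) by ring, pow_add _ (k j)]
  simp [pow_mul]

/-- The square of an odd vector field is the vector field whose coefficients are its values on
its own coefficients. -/
lemma vf_vf (hs : ∀ f, s (s f) = f) (hc : ∀ i, IsHom s (k i + 1) (c i))
    (hd : ∀ i, IsSuper s (k i) (d i))
    (hdd : ∀ i j f, d i (d j f) = (-1 : ℝ) ^ (k i * k j) • d j (d i f)) (f : A) :
    vf c d (vf c d f) = ∑ i, vf c d (c i) * d i f := by
  have hQ := isSuper_vf hs hc hd
  -- `F i j` is the term where the field differentiates `d i f` instead of the coefficient `c i`.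
  -- Exchanging the two coefficients (parities k + 1) and the two derivatives (parities k), together
  -- with the prefactor, always gives the total sign -1, so these terms cancel in pairs.
  set F : I → I → A := fun i j => (-1 : ℝ) ^ (k i + 1) • (c i * (c j * d j (d i f))) with hF
  have hanti : ∀ i j, F i j = - F j i := by
    intro i j
    simp only [hF]
    rw [hdd j i, ← mul_assoc, (hc i).2 (c j), (hc j).pow_apply, ← mul_assoc]
    simp only [mul_smul_comm, smul_mul_assoc, smul_smul, ← pow_add, ← neg_smul]
    congr 1
    rw [show k i + 1 + (k j * k i + (k i + 1) * (k j + 1)) = k j + 2 * (k i + 1 + k j * k i) by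
      ring, pow_add _ (k j), pow_mul]
    simp [pow_succ]
  have hzero : ∑ i, ∑ j, F i j = 0 := by
    have h1 : ∑ i, ∑ j, F i j = - ∑ i, ∑ j, F i j := by
      conv_lhs => rw [Finset.sum_comm]
      simp only [← Finset.sum_neg_distrib]
      exact Finset.sum_congr rfl fun i _ => Finset.sum_congr rfl fun j _ => hanti j i
    have h2 : (2 : ℝ) • ∑ i, ∑ j, F i j = 0 := by
      rw [two_smul]; nth_rewrite 1 [h1]; simp
    exact (smul_eq_zero.1 h2).resolve_left (by norm_num)
  have h : ∀ i, vf c d (c i * d i f) = vf c d (c i) * d i f + ∑ j, F i j := by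
    intro i
    rw [hQ.2, pow_one, (hc i).1, vf_apply c d (d i f), Finset.mul_sum]
    simp [hF]
  conv_lhs => rw [vf_apply c d f, map_sum]
  simp only [h, Finset.sum_add_distrib, hzero, add_zero]

end VectorField

end Super

/-! ### Alternating families and words -/

section Words

variable {A : Type*} [Ring A] {ι : Type*}

/-- The ordered product of the `w (K r)`. -/
def word {q : ℕ} (w : ι → A) (K : Fin q → ι) : A := (List.ofFn fun r => w (K r)).prod

lemma word_zero (w : ι → A) (K : Fin 0 → ι) : word w K = 1 := by simp [word]

lemma word_cons {q : ℕ} (w : ι → A) (j : ι) (K : Fin q → ι) :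
    word w (Fin.cons j K : Fin (q + 1) → ι) = w j * word w K := by
  simp [word, List.ofFn_succ]

lemma word_append {q r : ℕ} (w : ι → A) (K : Fin q → ι) (L : Fin r → ι) :
    word w (Fin.append K L) = word w K * word w L := by
  unfold word
  rw [← List.prod_append, ← List.ofFn_fin_append]
  congr 2
  ext i
  refine Fin.addCases (fun i => ?_) (fun i => ?_) i <;> simp

/-- The new factor is moved to the front past `r` anticommuting factors. -/
lemma word_insertNth {q : ℕ} {w : ι → A} (hw : ∀ j k, w j * w k = - (w k * w j)) (r : Fin (q + 1))
    (j : ι) (K : Fin q → ι) :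
    word w (r.insertNth j K : Fin (q + 1) → ι) = (-1) ^ (r : ℕ) * (w j * word w K) := by
  induction q with
  | zero =>
    refine Fin.cases ?_ (fun r => r.elim0) r
    simp [word_cons, Fin.insertNth_zero']
  | succ q ih =>
    refine Fin.cases ?_ (fun r => ?_) r
    · simp [Fin.insertNth_zero', word_cons]
    · obtain ⟨k, L, rfl⟩ : ∃ k L, K = Fin.cons k L := ⟨K 0, Fin.tail K, by simp⟩
      have : (r.succ.insertNth j (Fin.cons k L : Fin (q + 1) → ι) : Fin (q + 2) → ι)
          = Fin.cons k (r.insertNth j L : Fin (q + 1) → ι) := by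
        rw [Fin.insertNth_eq_iff]
        constructor
        · simp
        · ext t
          refine Fin.cases ?_ (fun t => ?_) t <;> simp [Fin.removeNth]
      rw [this, word_cons, ih, word_cons, Fin.val_succ, pow_succ', mul_assoc,
        ← mul_assoc (w j) (w k), hw j k]
      rcases neg_one_pow_eq_or A (r : ℕ) with h | h <;> simp [h, mul_assoc]

variable {B : Type*} [CommRing B]

/-- A family of ring elements indexed by multi-indices that is antisymmetric. -/
def Alt {q : ℕ} (c : (Fin q → ι) → B) : Prop :=
  ∀ K, ∀ σ : Equiv.Perm (Fin q), c (fun r => K (σ r)) = ((Equiv.Perm.sign σ : ℤ) : B) * c K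

lemma Alt.cons {q : ℕ} {c : (Fin (q + 1) → ι) → B} (hc : Alt c) (j : ι) :
    Alt fun K : Fin q → ι => c (Fin.cons j K) := by
  intro K σ
  -- The pair `(0, σ)` encodes the permutation that fixes 0 and acts as `σ` on the successors; it
  -- has the sign of `σ`.
  have := hc (Fin.cons j K) (Equiv.Perm.decomposeFin.symm (0, σ))
  rw [Equiv.Perm.decomposeFin.symm_sign] at this
  simp only [if_true, one_mul] at this
  beta_reduce
  rw [← this]
  congr 1
  funext r
  refine Fin.cases ?_ (fun r => ?_) r <;> simp

lemma Alt.swap {q : ℕ} {c : (Fin (q + 2) → ι) → B} (hc : Alt c) (j k : ι) (K : Fin q → ι) :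
    c (Fin.cons j (Fin.cons k K)) = - c (Fin.cons k (Fin.cons j K)) := by
  have h := hc (Fin.cons k (Fin.cons j K)) (Equiv.swap 0 1)
  rw [Equiv.Perm.sign_swap (by simp)] at h
  simp only [Units.val_neg, Units.val_one, Int.cast_neg, Int.cast_one, neg_mul, one_mul] at h
  rw [← h]
  congr 1
  funext r
  refine Fin.cases ?_ (fun r => ?_) r
  · simp
  · refine Fin.cases ?_ (fun r => ?_) r
    · simp
    · rw [Equiv.swap_apply_of_ne_of_ne (Fin.succ_ne_zero _)
        (by
          rw [← Fin.succ_zero_eq_one]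
          exact fun h => Fin.succ_ne_zero r (Fin.succ_injective _ h))]
      simp

lemma Alt.pair {c : (Fin 2 → ι) → B} (hc : Alt c) (j k : ι) : c ![j, k] = - c ![k, j] :=
  hc.swap j k ![]

variable [Fintype ι] {M : Type*} [AddCommMonoid M]

lemma sum_cons {q : ℕ} (F : (Fin (q + 1) → ι) → M) :
    ∑ K, F K = ∑ j, ∑ K : Fin q → ι, F (Fin.cons j K) := by
  rw [← (Fin.consEquiv fun _ : Fin (q + 1) => ι).sum_comp, Fintype.sum_prod_type]
  rfl

lemma sum_insertNth {q : ℕ} (r : Fin (q + 1)) (F : (Fin (q + 1) → ι) → M) :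
    ∑ K, F K = ∑ j, ∑ K : Fin q → ι, F (r.insertNth j K : Fin (q + 1) → ι) := by
  rw [← (Fin.insertNthEquiv (fun _ : Fin (q + 1) => ι) r).sum_comp, Fintype.sum_prod_type]
  rfl

lemma sum_append {q r : ℕ} (F : (Fin (q + r) → ι) → M) :
    ∑ K, F K = ∑ L : Fin r → ι, ∑ K : Fin q → ι, F (Fin.append K L) := by
  rw [← (Fin.appendEquiv q r).sum_comp, Fintype.sum_prod_type, Finset.sum_comm]
  rfl

lemma sum_pair (F : (Fin 2 → ι) → M) : ∑ K, F K = ∑ j, ∑ k, F ![j, k] := by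
  rw [sum_cons]
  refine Finset.sum_congr rfl fun j _ => ?_
  rw [sum_cons]
  refine Finset.sum_congr rfl fun k _ => ?_
  rw [Fintype.sum_unique, Subsingleton.elim (default : Fin 0 → ι) ![]]
  rfl

/-- A superderivation applied to an alternating polynomial in anticommuting elements. -/
lemma sum_mul_map_word (o : B →+* A) (ho : ∀ b f, o b * f = f * o b) {q : ℕ} {w : ι → A}
    {D : A → A} (ε : ℤ) (hD : ∀ j g, D (w j * g) = D (w j) * g + ε • (w j * D g))
    (hw : ∀ j k, ε • (w j * D (w k)) = - (D (w k) * w j)) {c : (Fin (q + 1) → ι) → B}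
    (hc : Alt c) :
    ∑ K, o (c K) * D (word w K)
      = (q + 1) • ∑ j, ∑ K : Fin q → ι, o (c (Fin.cons j K)) * (D (w j) * word w K) := by
  induction q with
  | zero =>
    rw [sum_cons]
    simp only [word_cons, word_zero, mul_one]
    simp
  | succ q ih =>
    -- The q + 1 factors after the first contribute as much each as the first one: the sign from
    -- moving `w j` past `D (w k)` cancels the sign from exchanging the first two indices of `c`.
    have key : ∑ j, ∑ K : Fin (q + 1) → ι, o (c (Fin.cons j K)) * (ε • (w j * D (word w K)))
        = (q + 1) • ∑ j, ∑ K : Fin (q + 1) → ι, o (c (Fin.cons j K)) * (D (w j) * word w K) := by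
      have h1 : ∀ j, ∑ K : Fin (q + 1) → ι, o (c (Fin.cons j K)) * (ε • (w j * D (word w K)))
          = (q + 1) • ∑ k, ∑ K : Fin q → ι,
            o (c (Fin.cons k (Fin.cons j K))) * (D (w k) * (w j * word w K)) := by
        intro j
        have h2 : ∑ K : Fin (q + 1) → ι, o (c (Fin.cons j K)) * (ε • (w j * D (word w K)))
            = ε • (w j * ∑ K : Fin (q + 1) → ι, o (c (Fin.cons j K)) * D (word w K)) := by
          simp only [Finset.mul_sum, Finset.smul_sum]
          refine Finset.sum_congr rfl fun K _ => ?_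
          rw [mul_smul_comm, ← mul_assoc, ho, mul_assoc]
        rw [h2, ih (hc.cons j), mul_smul_comm, smul_comm ε]
        congr 1
        simp only [Finset.mul_sum, Finset.smul_sum]
        refine Finset.sum_congr rfl fun k _ => Finset.sum_congr rfl fun K _ => ?_
        rw [← mul_assoc (w j), ← ho, mul_assoc, ← mul_smul_comm, ← mul_assoc (w j),
          ← smul_mul_assoc ε, hw, hc.swap j k, map_neg]
        simp only [neg_mul, mul_neg, neg_neg, mul_assoc]
      simp only [h1, ← Finset.smul_sum]
      congr 1
      rw [Finset.sum_comm]
      refine Finset.sum_congr rfl fun k _ => ?_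
      rw [sum_cons]
      simp only [word_cons]
    rw [sum_cons]
    simp only [word_cons, hD, mul_add, Finset.sum_add_distrib, key]
    rw [add_smul (q + 1) 1, one_smul, add_comm]

end Words

section AltLemmas

variable {ι B : Type*} [CommRing B] {q : ℕ}

lemma Alt.add {c d : (Fin q → ι) → B} (hc : Alt c) (hd : Alt d) : Alt fun K => c K + d K := by
  intro K σ
  simp only [hc K σ, hd K σ, mul_add]

lemma sign_mul_sign (σ : Equiv.Perm (Fin q)) :
    ((Equiv.Perm.sign σ : ℤ) : B) * ((Equiv.Perm.sign σ : ℤ) : B) = 1 := by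
  rcases Int.units_eq_one_or (Equiv.Perm.sign σ) with h | h <;> simp [h]

lemma Alt.map [Algebra ℝ B] {c : (Fin q → ι) → B} (hc : Alt c) (D : B →ₗ[ℝ] B) :
    Alt fun K => D (c K) := by
  intro K σ
  simp only [hc K σ]
  rcases Int.units_eq_one_or (Equiv.Perm.sign σ) with h | h <;> simp [h]

lemma alt_sum_perm (F : (Fin q → ι) → B) :
    Alt fun K => ∑ σ : Equiv.Perm (Fin q), ((Equiv.Perm.sign σ : ℤ) : B) * F fun r => K (σ r) := by
  intro K τ
  beta_reduce
  rw [Finset.mul_sum]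
  conv_rhs => rw [← Equiv.sum_comp (Equiv.mulLeft τ)]
  refine Finset.sum_congr rfl fun σ _ => ?_
  rw [Equiv.coe_mulLeft, Equiv.Perm.sign_mul, Units.val_mul, Int.cast_mul, ← mul_assoc,
    ← mul_assoc, sign_mul_sign, one_mul]
  rfl

end AltLemmas

/-! ### Computations in graded coordinates -/

/-- The parities of the coordinates `x, a, y, z`. -/
def par {n : ℕ} (p : ℕ) : Fin n ⊕ Fin n ⊕ Fin n ⊕ Fin n → ℕ :=
  Sum.elim (fun _ => 0) (Sum.elim (fun _ => 1) (Sum.elim (fun _ => p + 1) fun _ => p))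

/-- A superalgebra `A` over an algebra `B` of functions of coordinates `x`, with further graded
coordinates `a, y, z` and the partial derivatives with respect to `x, a, y, z`. -/
structure Frame (n p : ℕ) (A B : Type*) [Ring A] [Algebra ℝ A] [CommRing B] [Algebra ℝ B] where
  s : A →ₐ[ℝ] A
  o : B →ₐ[ℝ] A
  δ : Fin n → B →ₗ[ℝ] B
  X : Fin n → B
  ξ : Fin n ⊕ Fin n ⊕ Fin n → A
  d : Fin n ⊕ Fin n ⊕ Fin n ⊕ Fin n → A →ₗ[ℝ] A
  s_s : ∀ f, s (s f) = f
  o_hom : ∀ b, IsHom s 0 (o b)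
  o_inj : ∀ b, o b = 0 → b = 0
  δ_mul : ∀ i b c, δ i (b * c) = δ i b * c + b * δ i c
  δ_X : ∀ i j, δ i (X j) = if i = j then 1 else 0
  ξ_hom : ∀ j, IsHom s (par p (Sum.inr j)) (ξ j)
  d_super : ∀ i, IsSuper s (par p i) (d i)
  d_comm : ∀ i j f, d i (d j f) = (-1 : ℝ) ^ (par p i * par p j) • d j (d i f)
  dx_o : ∀ i b, d (Sum.inl i) (o b) = o (δ i b)
  dξ_o : ∀ j b, d (Sum.inr j) (o b) = 0
  d_ξ : ∀ i j, d i (ξ j) = if i = Sum.inr j then 1 else 0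

namespace Frame

variable {n p : ℕ} {A B : Type*} [Ring A] [Algebra ℝ A] [CommRing B] [Algebra ℝ B]
  (F : Frame n p A B)

/-- The coordinates `aᵢ`. -/
def a (i : Fin n) : A := F.ξ (Sum.inl i)
/-- The coordinates `yⁱ`. -/
def y (i : Fin n) : A := F.ξ (Sum.inr (Sum.inl i))
/-- The coordinates `zᵢ`. -/
def z (i : Fin n) : A := F.ξ (Sum.inr (Sum.inr i))
/-- `∂/∂xⁱ`. -/
def dx (i : Fin n) : A →ₗ[ℝ] A := F.d (Sum.inl i)
/-- `∂/∂aᵢ`. -/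
def da (i : Fin n) : A →ₗ[ℝ] A := F.d (Sum.inr (Sum.inl i))

lemma a_hom (i : Fin n) : IsHom F.s 1 (F.a i) := F.ξ_hom (Sum.inl i)
lemma y_hom (i : Fin n) : IsHom F.s (p + 1) (F.y i) := F.ξ_hom (Sum.inr (Sum.inl i))
lemma z_hom (i : Fin n) : IsHom F.s p (F.z i) := F.ξ_hom (Sum.inr (Sum.inr i))

lemma o_comm (b : B) (f : A) : F.o b * f = f * F.o b := by
  simpa using (F.o_hom b).2 f

lemma a_mul_a (j k : Fin n) : F.a j * F.a k = - (F.a k * F.a j) := by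
  have := (F.a_hom j).2 (F.a k)
  rw [(F.a_hom k).pow_apply] at this
  simpa using this

lemma word_hom {q : ℕ} {w : Fin n → A} (hw : ∀ i, IsHom F.s 1 (w i)) (K : Fin q → Fin n) :
    IsHom F.s q (word w K) := by
  induction q with
  | zero => rw [word_zero]; exact IsHom.one
  | succ q ih =>
    rw [← Fin.cons_self_tail K, word_cons]
    have := (hw (K 0)).mul (ih (Fin.tail K))
    rwa [add_comm 1 q] at this

/-- Linear combinations of the anticommuting `a` square to zero, so they define a homomorphism from
the exterior algebra. A word is the image of a wedge of basis vectors, whose alternation is known.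
-/
lemma word_perm {q : ℕ} (K : Fin q → Fin n) (σ : Equiv.Perm (Fin q)) :
    word F.a (fun r => K (σ r)) = ((Equiv.Perm.sign σ : ℤ) : A) * word F.a K := by
  let φ : (Fin n → ℝ) →ₗ[ℝ] A := Fintype.linearCombination ℝ F.a
  have hφ : ∀ v, φ v * φ v = 0 := by
    intro v
    have h : φ v * φ v = - (φ v * φ v) := by
      simp only [φ, Fintype.linearCombination_apply, Finset.sum_mul_sum]
      conv_rhs => rw [Finset.sum_comm, ← Finset.sum_neg_distrib]
      refine Finset.sum_congr rfl fun i _ => ?_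
      rw [← Finset.sum_neg_distrib]
      refine Finset.sum_congr rfl fun j _ => ?_
      rw [smul_mul_smul_comm, smul_mul_smul_comm, F.a_mul_a, smul_neg, mul_comm (v i)]
    have h2 : (2 : ℝ) • (φ v * φ v) = 0 := by
      rw [two_smul]; nth_rewrite 1 [h]; simp
    exact (smul_eq_zero.1 h2).resolve_left (by norm_num)
  have key : ∀ L : Fin q → Fin n, word F.a L = ExteriorAlgebra.lift ℝ ⟨φ, hφ⟩
      (ExteriorAlgebra.ιMulti ℝ q fun r => Pi.single (L r) 1) := by
    intro L
    rw [ExteriorAlgebra.ιMulti_apply, map_list_prod, List.map_ofFn, word]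
    congr 2
    ext r
    simp [φ, Fintype.linearCombination_apply, Pi.single_apply]
  have h := (ExteriorAlgebra.ιMulti ℝ q).map_perm
    (fun r => (Pi.single (K r) 1 : Fin n → ℝ)) σ
  rw [key, key]
  erw [h]
  rcases Int.units_eq_one_or (Equiv.Perm.sign σ) with h | h <;> simp [h]

/-- The function `(1/q!) T^{k₁…k_q} a_{k₁} ⋯ a_{k_q}`. -/
noncomputable def mv {q : ℕ} (T : (Fin q → Fin n) → B) : A :=
  (1 / (q.factorial : ℝ)) • ∑ K, F.o (T K) * word F.a K

lemma mv_hom {q : ℕ} (T : (Fin q → Fin n) → B) : IsHom F.s q (F.mv T) :=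
  IsHom.smul _ (IsHom.sum fun K _ => by
    simpa using (F.o_hom (T K)).mul (F.word_hom F.a_hom K))

lemma mv_add {q : ℕ} (S T : (Fin q → Fin n) → B) :
    F.mv (fun K => S K + T K) = F.mv S + F.mv T := by
  simp only [mv, map_add, add_mul, Finset.sum_add_distrib, smul_add]

lemma mv_zero {q : ℕ} : F.mv (fun _ : Fin q → Fin n => 0) = 0 := by simp [mv]

lemma mv_one (T : (Fin 1 → Fin n) → B) : F.mv T = ∑ k, F.o (T ![k]) * F.a k := by
  rw [mv, sum_cons]
  simp only [word_cons, word_zero, mul_one, Fintype.sum_unique, Nat.factorial_one, Nat.cast_one,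
    div_one, one_smul]
  refine Finset.sum_congr rfl fun k _ => ?_
  rw [Subsingleton.elim (default : Fin 0 → Fin n) ![]]
  rfl

lemma mv_two (T : (Fin 2 → Fin n) → B) :
    F.mv T = (1 / 2 : ℝ) • ∑ j, ∑ k, F.o (T ![j, k]) * F.a j * F.a k := by
  rw [mv, sum_pair]
  simp [word, mul_assoc]

lemma factorial_smul (q : ℕ) (f : A) :
    (1 / ((q + 1).factorial : ℝ)) • ((q + 1) • f) = (1 / (q.factorial : ℝ)) • f := by
  rw [← Nat.cast_smul_eq_nsmul ℝ, smul_smul]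
  congr 1
  rw [Nat.factorial_succ]
  have : (q.factorial : ℝ) ≠ 0 := by positivity
  push_cast
  field_simp

lemma d_o_mul (i : Fin n ⊕ Fin n ⊕ Fin n ⊕ Fin n) (b : B) (f : A) :
    F.d i (F.o b * f) = F.d i (F.o b) * f + F.o b * F.d i f := by
  rw [(F.d_super i).2, (F.o_hom b).pow_apply]
  simp

lemma dξ_o_mul (j : Fin n ⊕ Fin n ⊕ Fin n) (b : B) (f : A) :
    F.d (Sum.inr j) (F.o b * f) = F.o b * F.d (Sum.inr j) f := by
  rw [d_o_mul, dξ_o, zero_mul, zero_add]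

lemma d_word {q : ℕ} {i : Fin n ⊕ Fin n ⊕ Fin n ⊕ Fin n} {w : Fin n → A}
    (hw : ∀ j, F.d i (w j) = 0) (K : Fin q → Fin n) : F.d i (word w K) = 0 := by
  induction q with
  | zero => rw [word_zero]; exact (F.d_super i).map_one
  | succ q ih =>
    rw [← Fin.cons_self_tail K, word_cons, (F.d_super i).2, hw, ih]
    simp

lemma dx_mv (i : Fin n) {q : ℕ} (T : (Fin q → Fin n) → B) :
    F.dx i (F.mv T) = F.mv fun K => F.δ i (T K) := by
  unfold mv dx
  rw [map_smul, map_sum]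
  congr 1
  refine Finset.sum_congr rfl fun K _ => ?_
  rw [d_o_mul, dx_o, F.d_word (fun j => by simp [a, d_ξ])]
  simp

lemma d_yz_mv (i : Fin n ⊕ Fin n) {q : ℕ} (T : (Fin q → Fin n) → B) :
    F.d (Sum.inr (Sum.inr i)) (F.mv T) = 0 := by
  unfold mv
  rw [map_smul, map_sum, Finset.sum_eq_zero, smul_zero]
  intro K _
  rw [dξ_o_mul, F.d_word (fun j => by simp [a, d_ξ]), mul_zero]

lemma da_mv (i : Fin n) {q : ℕ} {T : (Fin (q + 1) → Fin n) → B} (hT : Alt T) :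
    F.da i (F.mv T) = F.mv fun K => T (Fin.cons i K) := by
  unfold mv da
  simp only [map_smul, map_sum, dξ_o_mul]
  -- Here ε = -1: both the derivative and the factors are odd.
  have h := sum_mul_map_word (F.o : B →+* A) F.o_comm (w := F.a)
    (D := F.d (Sum.inr (Sum.inl i))) (-1)
    (fun j g => by
      rw [(F.d_super _).2]
      change _ + (F.s ^ 1) (F.a j) * _ = _
      rw [(F.a_hom j).pow_apply]
      simp)
    (fun j k => by
      simp only [a, d_ξ]
      split_ifs <;> simp) hT
  simp only [RingHom.coe_coe] at h
  rw [h, factorial_smul]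
  congr 1
  rw [Finset.sum_eq_single i]
  · simp [a, d_ξ]
  · intro j _ hj
    refine Finset.sum_eq_zero fun K _ => ?_
    simp [a, d_ξ, Ne.symm hj]
  · simp

/-- Differentiation in `a` strips off one index at a time, until only a function of x is left, on
which `F.o` is injective. -/
lemma mv_eq_zero {q : ℕ} {T : (Fin q → Fin n) → B} (hT : Alt T) (h : F.mv T = 0)
    (K : Fin q → Fin n) : T K = 0 := by
  induction q with
  | zero =>
    rw [mv, Fintype.sum_unique, word_zero] at h
    rw [Subsingleton.elim K default]
    exact F.o_inj _ (by simpa using h)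
  | succ q ih =>
    rw [← Fin.cons_self_tail K]
    refine ih (hT.cons (K 0)) ?_ _
    rw [← F.da_mv (K 0) hT, h, map_zero]

/-- Relabelling by `σ` produces the sign of `σ` a second time from the word, so all q! permutations
give the same sum and the factorial cancels. This lets the Schouten bracket be computed before its
antisymmetrization. -/
lemma mv_sum_perm {q : ℕ} (T : (Fin q → Fin n) → B) :
    F.mv (fun K => ∑ σ : Equiv.Perm (Fin q), ((Equiv.Perm.sign σ : ℤ) : B) * T fun r => K (σ r))
      = ∑ K, F.o (T K) * word F.a K := by
  unfold mv
  simp only [map_sum, Finset.sum_mul, map_mul, map_intCast]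
  rw [Finset.sum_comm]
  have h : ∀ σ : Equiv.Perm (Fin q), ∑ K : Fin q → Fin n,
      ((Equiv.Perm.sign σ : ℤ) : A) * F.o (T fun r => K (σ r)) * word F.a K
        = ∑ K, F.o (T K) * word F.a K := by
    intro σ
    rw [← (Equiv.arrowCongr σ (Equiv.refl (Fin n))).sum_comp]
    refine Finset.sum_congr rfl fun K _ => ?_
    have h1 : (fun r => (Equiv.arrowCongr σ (Equiv.refl (Fin n))) K (σ r)) = K := by
      ext r; simp [Equiv.arrowCongr]
    have h2 := F.word_perm ((Equiv.arrowCongr σ (Equiv.refl (Fin n))) K) σ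
    rw [h1] at h2 ⊢
    rw [h2, ← mul_assoc]
    rcases Int.units_eq_one_or (Equiv.Perm.sign σ) with h | h <;> simp [h]
  simp only [h, Finset.sum_const, Finset.card_univ, Fintype.card_perm, Fintype.card_fin]
  rw [← Nat.cast_smul_eq_nsmul ℝ, smul_smul, one_div, inv_mul_cancel₀ (by positivity), one_smul]

end Frame

/-! ### The vector field Q and its action on functions of x and a -/

namespace Frame

variable {n p : ℕ} {A B : Type*} [Ring A] [Algebra ℝ A] [CommRing B] [Algebra ℝ B]
  (F : Frame n p A B)
  (P : (Fin 2 → Fin n) → B) (R : (Fin (p + 1) → Fin n) → B) (H : (Fin (p + 2) → Fin n) → B)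

/-- The components `P^{k₁l₁} ⋯ P^{k_ql_q} η_{l₁…l_q}`. -/
def contr {q : ℕ} (η : (Fin q → Fin n) → B) (K : Fin q → Fin n) : B :=
  ∑ L : Fin q → Fin n, (∏ r, P ![K r, L r]) * η L

/-- The Schouten bracket of `P` and `T` before antisymmetrization. -/
noncomputable def schTerm {q : ℕ} (T : (Fin (q + 1) → Fin n) → B) (K : Fin (q + 2) → Fin n) : B :=
  (1 / ((q + 1).factorial : ℝ)) •
      ∑ i : Fin n, P ![K 0, i] * F.δ i (T fun r : Fin (q + 1) => K r.succ)
    - (1 / (2 * (q.factorial : ℝ))) •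
      ∑ i : Fin n, T (Fin.cons i fun r : Fin q => K (Fin.castAdd 2 r)) *
        F.δ i (P ![K (Fin.natAdd q 0), K (Fin.natAdd q 1)])

/-- The components of the Schouten bracket of `P` and `T`. -/
noncomputable def sch {q : ℕ} (T : (Fin (q + 1) → Fin n) → B) (K : Fin (q + 2) → Fin n) : B :=
  ∑ σ : Equiv.Perm (Fin (q + 2)), ((Equiv.Perm.sign σ : ℤ) : B) *
    F.schTerm P T fun r => K (σ r)

lemma sch_alt {q : ℕ} (T : (Fin (q + 1) → Fin n) → B) : Alt (F.sch P T) := alt_sum_perm _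

/-- `Q xⁱ`. -/
def qx (i : Fin n) : A := ∑ j, F.o (P ![j, i]) * F.a j

/-- `Q aᵢ`. -/
noncomputable def qa (i : Fin n) : A :=
  -(1 / 2 : ℝ) • ∑ j, ∑ k, F.o (F.δ i (P ![j, k])) * F.a j * F.a k

/-- `Q yⁱ`. -/
noncomputable def qy (i : Fin n) : A :=
  (-1 : ℝ) ^ p • ∑ j, F.o (P ![j, i]) * F.z j
    - ∑ j, ∑ k, F.o (F.δ j (P ![i, k])) * F.a k * F.y j
    + (1 / (p.factorial : ℝ)) • ∑ J : Fin p → Fin n, F.o (R (Fin.cons i J)) * word F.a J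

/-- `Q zᵢ`. -/
noncomputable def qz (i : Fin n) : A :=
  ∑ j, ∑ k, F.o (F.δ i (P ![j, k])) * F.a k * F.z j
    - ((-1 : ℝ) ^ p / 2) •
        ∑ j, ∑ k, ∑ l, F.o (F.δ i (F.δ j (P ![k, l]))) * F.y j * F.a k * F.a l
    + ((-1 : ℝ) ^ p / ((p + 1).factorial : ℝ)) • ∑ K : Fin (p + 1) → Fin n,
        F.o (F.δ i (R K) + contr P (fun L => H (Fin.cons i L)) K) * word F.a K

/-- The coefficients of `Q`. -/
noncomputable def coef : Fin n ⊕ Fin n ⊕ Fin n ⊕ Fin n → A :=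
  Sum.elim (F.qx P) (Sum.elim (F.qa P) (Sum.elim (F.qy P R) (F.qz P R H)))

/-- The vector field `Q`. -/
noncomputable def Q : A →ₗ[ℝ] A := vf (F.coef P R H) F.d

lemma o_mul_hom (b : B) {k : ℕ} {f : A} (hf : IsHom F.s k f) : IsHom F.s k (F.o b * f) := by
  simpa using (F.o_hom b).mul hf

lemma qx_hom (i : Fin n) : IsHom F.s 1 (F.qx P i) :=
  IsHom.sum fun j _ => F.o_mul_hom _ (F.a_hom j)

lemma coef_hom (i : Fin n ⊕ Fin n ⊕ Fin n ⊕ Fin n) :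
    IsHom F.s (par p i + 1) (F.coef P R H i) := by
  rcases i with i | i | i | i
  · exact F.qx_hom P i
  · refine IsHom.smul _ (IsHom.sum fun j _ => IsHom.sum fun k _ => ?_)
    exact (F.o_mul_hom _ (F.a_hom j)).mul (F.a_hom k)
  · refine IsHom.add (IsHom.sub (IsHom.smul _ (IsHom.sum fun j _ => ?_))
      (IsHom.sum fun j _ => IsHom.sum fun k _ => ?_)) (IsHom.smul _ (IsHom.sum fun J _ => ?_))
    · exact (F.o_mul_hom _ (F.z_hom j)).congr F.s_s (by simp [par]; omega)
    · exact ((F.o_mul_hom _ (F.a_hom k)).mul (F.y_hom j)).congr F.s_s (by simp [par]; omega)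
    · exact (F.o_mul_hom _ (F.word_hom F.a_hom J)).congr F.s_s (by simp [par]; omega)
  · refine IsHom.add (IsHom.sub (IsHom.sum fun j _ => IsHom.sum fun k _ => ?_)
      (IsHom.smul _ (IsHom.sum fun j _ => IsHom.sum fun k _ => IsHom.sum fun l _ => ?_)))
      (IsHom.smul _ (IsHom.sum fun K _ => ?_))
    · exact ((F.o_mul_hom _ (F.a_hom k)).mul (F.z_hom j)).congr F.s_s (by simp [par]; omega)
    · exact (((F.o_mul_hom _ (F.y_hom j)).mul (F.a_hom k)).mul (F.a_hom l)).congr F.s_s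
        (by simp [par]; omega)
    · exact F.o_mul_hom _ (F.word_hom F.a_hom K)

lemma Q_super : IsSuper F.s 1 (F.Q P R H) :=
  isSuper_vf F.s_s (F.coef_hom P R H) F.d_super

lemma Q_apply (f : A) : F.Q P R H f = ∑ i, F.qx P i * F.dx i f + ∑ i, F.qa P i * F.da i f
    + (∑ i, F.qy P R i * F.d (Sum.inr (Sum.inr (Sum.inl i))) f
      + ∑ i, F.qz P R H i * F.d (Sum.inr (Sum.inr (Sum.inr i))) f) := by
  rw [Q, vf_apply]
  simp only [Fintype.sum_sum_type, add_assoc]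
  rfl

lemma Q_o (b : B) : F.Q P R H (F.o b) = ∑ i, F.qx P i * F.o (F.δ i b) := by
  simp [Q_apply, dx, da, dx_o, dξ_o]

lemma Q_a (i : Fin n) : F.Q P R H (F.a i) = F.qa P i := by
  simp [Q_apply, dx, da, a, d_ξ]

lemma Q_y (i : Fin n) : F.Q P R H (F.y i) = F.qy P R i := by
  simp [Q_apply, dx, da, y, d_ξ]

lemma Q_z (i : Fin n) : F.Q P R H (F.z i) = F.qz P R H i := by
  simp [Q_apply, dx, da, z, d_ξ]

lemma Q_X (i : Fin n) : F.Q P R H (F.o (F.X i)) = F.qx P i := by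
  simp [Q_o, δ_X]

lemma Q_mul (k : ℕ) {f : A} (hf : IsHom F.s k f) (g : A) :
    F.Q P R H (f * g) = F.Q P R H f * g + (-1 : ℝ) ^ k • (f * F.Q P R H g) := by
  rw [(F.Q_super P R H).2, hf.pow_apply, one_mul, smul_mul_assoc]

/-- A function of the coordinates `x` and `a` only. -/
def NoYZ (f : A) : Prop := ∀ i, F.d (Sum.inr (Sum.inr i)) f = 0

variable {F}

lemma Q_of_noYZ {f : A} (hf : F.NoYZ f) :
    F.Q P R H f = ∑ i, (F.qx P i * F.dx i f + F.qa P i * F.da i f) := by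
  simp [Q_apply, hf _, Finset.sum_add_distrib]

/-- A partial derivative passes through Q at the cost of differentiating the coefficients of Q. With
no y, z in `f`, only the coefficients along x and a appear. -/
lemma dx_Q {f : A} (hf : F.NoYZ f) (j : Fin n) :
    F.dx j (F.Q P R H f) = ∑ i, (F.dx j (F.qx P i) * F.dx i f + F.dx j (F.qa P i) * F.da i f)
      + F.Q P R H (F.dx j f) := by
  have := d_vf (F.coef_hom P R H) F.d_super F.d_comm (Sum.inl j) f
  rw [Fintype.sum_sum_type, Fintype.sum_sum_type] at this
  simp only [hf _, mul_zero, Finset.sum_const_zero, add_zero, par, Sum.elim_inl, pow_zero,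
    one_smul] at this
  rw [Finset.sum_add_distrib]
  exact this

lemma da_Q {f : A} (hf : F.NoYZ f) (j : Fin n) :
    F.da j (F.Q P R H f) = ∑ i, (F.da j (F.qx P i) * F.dx i f + F.da j (F.qa P i) * F.da i f)
      - F.Q P R H (F.da j f) := by
  have := d_vf (F.coef_hom P R H) F.d_super F.d_comm (Sum.inr (Sum.inl j)) f
  rw [Fintype.sum_sum_type, Fintype.sum_sum_type] at this
  simp only [hf _, mul_zero, Finset.sum_const_zero, add_zero, par, Sum.elim_inl, Sum.elim_inr,
    pow_one, neg_smul, one_smul] at this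
  rw [Finset.sum_add_distrib, sub_eq_add_neg]
  exact this

variable (F) {P R H}

lemma noYZ_mv {q : ℕ} (T : (Fin q → Fin n) → B) : F.NoYZ (F.mv T) := fun i => F.d_yz_mv i T

/-- With `qa_eq`, this is the Hamiltonian form of Q on functions of x and a, with Hamiltonian π =
`F.mv P`. -/
lemma qx_eq (hP : Alt P) (i : Fin n) : F.qx P i = - F.da i (F.mv P) := by
  rw [F.da_mv i hP, mv_one, ← Finset.sum_neg_distrib]
  refine Finset.sum_congr rfl fun j _ => ?_
  rw [hP.pair j i, map_neg, neg_mul]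
  rfl

lemma qa_eq (i : Fin n) : F.qa P i = - F.dx i (F.mv P) := by
  rw [dx_mv, mv_two, qa, neg_smul]

lemma qx_eq_mv (hP : Alt P) (i : Fin n) : F.qx P i = - F.mv fun K => P (Fin.cons i K) := by
  rw [F.qx_eq hP, F.da_mv i hP]

lemma qa_eq_mv (i : Fin n) : F.qa P i = - F.mv fun K => F.δ i (P K) := by
  rw [F.qa_eq, F.dx_mv]

lemma noYZ_neg {f : A} (hf : F.NoYZ f) : F.NoYZ (-f) := fun i => by rw [map_neg, hf, neg_zero]

lemma noYZ_qx (hP : Alt P) (i : Fin n) : F.NoYZ (F.qx P i) := by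
  rw [F.qx_eq_mv hP]; exact F.noYZ_neg (F.noYZ_mv _)

lemma noYZ_qa (i : Fin n) : F.NoYZ (F.qa P i) := by
  rw [F.qa_eq_mv]; exact F.noYZ_neg (F.noYZ_mv _)

lemma da_qx (i j : Fin n) : F.da i (F.qx P j) = F.o (P ![i, j]) := by
  simp only [qx, map_sum, da, dξ_o_mul, a, d_ξ]
  simp

lemma da_qa_eq (hP : Alt P) (i j : Fin n) :
    F.da i (F.qa P j) = - F.mv fun K => F.δ j (P (Fin.cons i K)) := by
  rw [F.qa_eq_mv, map_neg, F.da_mv i (hP.map _)]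

lemma dx_qx_eq (hP : Alt P) (i j : Fin n) :
    F.dx i (F.qx P j) = - F.mv fun K => F.δ i (P (Fin.cons j K)) := by
  rw [F.qx_eq_mv hP, map_neg, F.dx_mv]

lemma dx_qa_eq (i j : Fin n) :
    F.dx i (F.qa P j) = - F.mv fun K => F.δ i (F.δ j (P K)) := by
  rw [F.qa_eq_mv, map_neg, F.dx_mv]

lemma da_qa_hom (hP : Alt P) (i j : Fin n) : IsHom F.s 1 (F.da i (F.qa P j)) := by
  rw [F.da_qa_eq hP]; exact (F.mv_hom _).neg

lemma dx_qx_hom (hP : Alt P) (i j : Fin n) : IsHom F.s 1 (F.dx i (F.qx P j)) := by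
  rw [F.dx_qx_eq hP]; exact (F.mv_hom _).neg

lemma dx_qa_hom (i j : Fin n) : IsHom F.s 2 (F.dx i (F.qa P j)) := by
  rw [F.dx_qa_eq]; exact (F.mv_hom _).neg

lemma qa_hom (j : Fin n) : IsHom F.s 2 (F.qa P j) := by
  rw [F.qa_eq_mv]; exact (F.mv_hom _).neg

lemma hom_one_anticomm {f g : A} (hf : IsHom F.s 1 f) (hg : IsHom F.s 1 g) :
    f * g = - (g * f) := by
  rw [hf.2, hg.pow_apply]; simp

lemma hom_two_comm {f : A} (hf : IsHom F.s 2 f) (g : A) : f * g = g * f := by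
  have h : IsHom F.s 0 f := hf.congr F.s_s (by norm_num)
  rw [h.2]; simp

/-- Both halves of Qπ equal -∑ (Q xᵏ)(Q aₖ), because Q aₖ is even and hence central. -/
lemma Q_pi (hP : Alt P) :
    F.Q P R H (F.mv P) = -((2 : ℝ) • ∑ k, F.qx P k * F.qa P k) := by
  rw [Q_of_noYZ P R H (F.noYZ_mv P), Finset.smul_sum, ← Finset.sum_neg_distrib]
  refine Finset.sum_congr rfl fun k _ => ?_
  rw [← neg_eq_iff_eq_neg.2 (F.qx_eq hP k), ← neg_eq_iff_eq_neg.2 (F.qa_eq k), mul_neg, mul_neg,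
    F.hom_two_comm (F.qa_hom k), two_smul]
  abel

/-- `Q² xⁱ = (1/2) ∂/∂aᵢ (Q π)`. -/
lemma Q_qx (hP : Alt P) (j : Fin n) :
    F.Q P R H (F.qx P j) = (1 / 2 : ℝ) • F.da j (F.Q P R H (F.mv P)) := by
  -- The derivative of Qπ is computed in two ways: commuting it with Q gives -S + Q(Q xʲ), while
  -- differentiating the product formula `Q_pi` gives -2S. Comparison gives Q(Q xʲ) = -S.
  set S := ∑ k, (F.da j (F.qx P k) * F.qa P k + F.da j (F.qa P k) * F.qx P k) with hS
  have h1 : F.da j (F.Q P R H (F.mv P)) = - S + F.Q P R H (F.qx P j) := by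
    rw [da_Q P R H (F.noYZ_mv P), ← neg_eq_iff_eq_neg.2 (F.qx_eq hP j), map_neg, sub_neg_eq_add,
      hS, ← Finset.sum_neg_distrib]
    congr 1
    refine Finset.sum_congr rfl fun k _ => ?_
    rw [← neg_eq_iff_eq_neg.2 (F.qx_eq hP k), ← neg_eq_iff_eq_neg.2 (F.qa_eq k), mul_neg, mul_neg,
      neg_add]
  have h2 : F.da j (F.Q P R H (F.mv P)) = - ((2 : ℝ) • S) := by
    rw [F.Q_pi hP, map_neg, map_smul, map_sum, hS]
    congr 2
    refine Finset.sum_congr rfl fun k _ => ?_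
    have := (F.d_super (Sum.inr (Sum.inl j))).2 (F.qx P k) (F.qa P k)
    rw [(F.qx_hom P k).pow_apply] at this
    change F.da j _ = F.da j _ * _ + _ * F.da j _ at this
    rw [this, F.hom_one_anticomm (F.da_qa_hom hP j k) (F.qx_hom P k)]
    simp [par]
  have h3 : F.Q P R H (F.qx P j) = - S := by
    rw [h2, two_smul] at h1
    have := congrArg (· + S) h1
    simp only [neg_add_cancel_comm] at this
    rw [← this]; abel
  rw [h2, h3, smul_neg, smul_smul]
  norm_num

/-- `Q² aᵢ = -(1/2) ∂/∂xⁱ (Q π)`. -/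
lemma Q_qa (hP : Alt P) (j : Fin n) :
    F.Q P R H (F.qa P j) = -(1 / 2 : ℝ) • F.dx j (F.Q P R H (F.mv P)) := by
  -- The same comparison with ∂/∂xʲ: -S - Q(Q aⱼ) = -2S, so Q(Q aⱼ) = S.
  set S := ∑ k, (F.dx j (F.qx P k) * F.qa P k + F.dx j (F.qa P k) * F.qx P k) with hS
  have h1 : F.dx j (F.Q P R H (F.mv P)) = - S - F.Q P R H (F.qa P j) := by
    rw [dx_Q P R H (F.noYZ_mv P), ← neg_eq_iff_eq_neg.2 (F.qa_eq j), map_neg, ← sub_eq_add_neg,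
      hS, ← Finset.sum_neg_distrib]
    congr 1
    refine Finset.sum_congr rfl fun k _ => ?_
    rw [← neg_eq_iff_eq_neg.2 (F.qx_eq hP k), ← neg_eq_iff_eq_neg.2 (F.qa_eq k), mul_neg, mul_neg,
      neg_add]
  have h2 : F.dx j (F.Q P R H (F.mv P)) = - ((2 : ℝ) • S) := by
    rw [F.Q_pi hP, map_neg, map_smul, map_sum, hS]
    congr 2
    refine Finset.sum_congr rfl fun k _ => ?_
    have := (F.d_super (Sum.inl j)).2 (F.qx P k) (F.qa P k)
    rw [(F.qx_hom P k).pow_apply] at this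
    change F.dx j _ = F.dx j _ * _ + _ * F.dx j _ at this
    rw [this, F.hom_two_comm (F.dx_qa_hom j k) (F.qx P k)]
    simp [par]
  have h3 : F.Q P R H (F.qa P j) = S := by
    rw [h2, two_smul] at h1
    have := congrArg (fun f => f + S + S + F.Q P R H (F.qa P j)) h1
    beta_reduce at this
    rw [show -(S + S) + S + S + F.Q P R H (F.qa P j) = F.Q P R H (F.qa P j) by abel] at this
    rw [this]; abel
  rw [h2, h3, smul_neg, smul_smul]
  norm_num

/-- `Q` acts on polynomials in the coordinates `a` by the Schouten bracket. -/
lemma Q_mv {q : ℕ} {T : (Fin (q + 1) → Fin n) → B} (hT : Alt T) :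
    F.Q P R H (F.mv T) = F.mv (F.sch P T) := by
  have h1 : F.mv (F.sch P T) = ∑ K, F.o (F.schTerm P T K) * word F.a K :=
    F.mv_sum_perm (F.schTerm P T)
  -- The first term of the bracket is the part of Q along x, the second (`h3`) the part along a. In
  -- `h3` the last two indices, those of P, are split off.
  have h2 : ∑ K : Fin (q + 2) → Fin n, F.o
      ((1 / ((q + 1).factorial : ℝ)) • ∑ i : Fin n, P ![K 0, i] * F.δ i (T fun r => K r.succ))
        * word F.a K = ∑ i, F.qx P i * F.dx i (F.mv T) := by
    rw [sum_cons]
    simp only [F.dx_mv]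
    simp only [Fin.cons_zero, Fin.cons_succ, word_cons, map_smul, map_sum, qx, mv,
      mul_smul_comm, smul_mul_assoc, Finset.smul_sum, Finset.sum_mul, Finset.mul_sum, map_mul]
    rw [Finset.sum_congr rfl fun j _ => Finset.sum_comm, Finset.sum_comm]
    refine Finset.sum_congr rfl fun i _ => ?_
    rw [Finset.sum_comm]
    refine Finset.sum_congr rfl fun K _ => Finset.sum_congr rfl fun j _ => ?_
    rw [mul_assoc, mul_assoc, ← mul_assoc (F.a j), ← F.o_comm, mul_assoc]
  have h3 : ∑ K : Fin (q + 2) → Fin n, F.o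
      ((1 / (2 * (q.factorial : ℝ))) • ∑ i : Fin n,
        T (Fin.cons i fun r => K (Fin.castAdd 2 r)) *
          F.δ i (P ![K (Fin.natAdd q 0), K (Fin.natAdd q 1)])) * word F.a K
        = - ∑ i, F.qa P i * F.da i (F.mv T) := by
    rw [sum_append]
    simp only [Fin.append_left, Fin.append_right, word_append, F.da_mv _ hT]
    rw [← Finset.sum_neg_distrib]
    have h4 : ∀ i, - (F.qa P i * F.mv fun K => T (Fin.cons i K))
        = (1 / (2 * (q.factorial : ℝ))) • ∑ L : Fin 2 → Fin n, ∑ K : Fin q → Fin n,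
          F.o (T (Fin.cons i K)) * F.o (F.δ i (P L)) * (word F.a K * word F.a L) := by
      intro i
      rw [F.qa_eq_mv, neg_mul, neg_neg, mv, mv, smul_mul_smul_comm]
      congr 1
      · simp [mul_comm]
      · rw [Finset.sum_mul_sum]
        refine Finset.sum_congr rfl fun L _ => Finset.sum_congr rfl fun K _ => ?_
        -- The two `a` coming from Q aᵢ form an even element, which moves to the end of the word
        -- without a sign.
        rw [mul_assoc, F.hom_two_comm (F.word_hom F.a_hom L), ← mul_assoc, ← mul_assoc, ← map_mul,
          ← map_mul, mul_comm, mul_assoc]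
    simp only [h4, ← Finset.smul_sum]
    simp only [map_smul, map_sum, smul_mul_assoc, ← Finset.smul_sum, Finset.sum_mul, map_mul]
    congr 1
    rw [Finset.sum_congr rfl fun j _ => Finset.sum_comm, Finset.sum_comm]
    refine Finset.sum_congr rfl fun i _ => Finset.sum_congr rfl fun L _ => ?_
    refine Finset.sum_congr rfl fun K _ => ?_
    rw [show ![L 0, L 1] = L by ext r; fin_cases r <;> rfl]
  rw [h1, Q_of_noYZ P R H (F.noYZ_mv T)]
  simp only [schTerm, map_sub, sub_mul, Finset.sum_sub_distrib, Finset.sum_add_distrib, h2, h3,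
    sub_neg_eq_add]

end Frame

/-! ### The square of Q on the coordinates y and z -/

namespace Frame

section Cancel

variable {n : ℕ} {A : Type*} [Ring A] (u v : Fin n → A) (M N : Fin n → Fin n → A) (W V : Fin n → A)

/-- The double sum `u M W`. -/
def dsum : A := ∑ j, ∑ k, u j * (M j k * W k)

lemma sum_sum_mul :
    ∑ j, (∑ k, (u k * M k j + v k * N k j)) * W j = dsum u M W + dsum v N W := by
  simp only [dsum, Finset.sum_mul, Finset.sum_add_distrib, add_mul, mul_assoc]
  congr 1 <;> rw [Finset.sum_comm]

lemma sum_mul_sum_add [Algebra ℝ A] (r : Fin n → A) (α β : ℝ) :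
    ∑ j, u j * (∑ k, (α • (M j k * W k) + β • (N j k * V k)) + r j)
      = α • dsum u M W + β • dsum u N V + ∑ j, u j * r j := by
  simp only [dsum, mul_add, Finset.sum_add_distrib, Finset.mul_sum, Finset.smul_sum,
    mul_smul_comm]

end Cancel


variable {n p : ℕ} {A B : Type*} [Ring A] [Algebra ℝ A] [CommRing B] [Algebra ℝ B]
  (F : Frame n p A B)
  {P : (Fin 2 → Fin n) → B} {R : (Fin (p + 1) → Fin n) → B} {H : (Fin (p + 2) → Fin n) → B}

lemma contr_alt {B : Type*} [CommRing B] {P : (Fin 2 → Fin n) → B} {q : ℕ}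
    {η : (Fin q → Fin n) → B} (hη : Alt η) : Alt (contr P η) := by
  intro K σ
  unfold contr
  rw [← (Equiv.arrowCongr σ⁻¹ (Equiv.refl (Fin n))).sum_comp, Finset.mul_sum]
  refine Finset.sum_congr rfl fun L _ => ?_
  have h1 : (Equiv.arrowCongr σ⁻¹ (Equiv.refl (Fin n))) L = fun r => L (σ r) := by
    ext r; simp [Equiv.arrowCongr, ← Equiv.Perm.inv_def]
  rw [h1, hη L σ, Equiv.prod_comp σ fun r => P ![K r, L r]]
  ring

-- Together with `mv_contr`: contracting all indices of a form with P amounts to replacing each dxˡ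
-- by Q xˡ.
variable (P) in
lemma word_qx {q : ℕ} (L : Fin q → Fin n) :
    word (F.qx P) L = ∑ K : Fin q → Fin n, F.o (∏ r, P ![K r, L r]) * word F.a K := by
  induction q with
  | zero => simp [word_zero]
  | succ q ih =>
    rw [← Fin.cons_self_tail L, word_cons, ih, sum_cons, qx, Finset.sum_mul_sum]
    refine Finset.sum_congr rfl fun j _ => Finset.sum_congr rfl fun K _ => ?_
    rw [Fin.prod_univ_succ, word_cons]
    simp only [Fin.cons_zero, Fin.cons_succ, map_mul]
    rw [mul_assoc, ← mul_assoc (F.a j), ← F.o_comm]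
    simp only [mul_assoc]

variable (P) in
lemma mv_contr {q : ℕ} (η : (Fin q → Fin n) → B) :
    F.mv (contr P η) = (1 / (q.factorial : ℝ)) • ∑ L, F.o (η L) * word (F.qx P) L := by
  unfold mv contr
  congr 1
  simp only [map_sum, Finset.sum_mul, word_qx, Finset.mul_sum]
  rw [Finset.sum_comm]
  refine Finset.sum_congr rfl fun L _ => Finset.sum_congr rfl fun K _ => ?_
  rw [← mul_assoc, ← map_mul, mul_comm]

variable (P H) in
/-- The contraction of `H` with `⊗ P` in all but its first argument. -/
noncomputable def twist (i : Fin n) : A := F.mv (contr P fun L => H (Fin.cons i L))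

/-- The chain rule for the substitution dxˡ ↦ Q xˡ: `twist` is the same substitution in the interior
product of H with a coordinate field. -/
lemma da_mv_contr (hH : Alt H) (i : Fin n) :
    F.da i (F.mv (contr P H)) = ∑ k, F.da i (F.qx P k) * F.twist P H k := by
  rw [F.da_mv i (contr_alt hH)]
  have h : (fun K => contr P H (Fin.cons i K))
      = fun K => ∑ k, P ![i, k] * contr P (fun L => H (Fin.cons k L)) K := by
    ext K
    unfold contr
    rw [sum_cons]
    refine Finset.sum_congr rfl fun k _ => ?_
    rw [Finset.mul_sum]
    refine Finset.sum_congr rfl fun L _ => ?_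
    rw [Fin.prod_univ_succ]
    simp only [Fin.cons_zero, Fin.cons_succ, mul_assoc]
  rw [h]
  simp only [da_qx, twist, mv, map_sum, map_mul, Finset.sum_mul, mul_smul_comm, Finset.mul_sum,
    ← Finset.smul_sum]
  rw [Finset.sum_comm]
  simp only [mul_assoc]

lemma Q_word_qx (hx : ∀ j, F.Q P R H (F.qx P j) = 0) {q : ℕ} (L : Fin q → Fin n) :
    F.Q P R H (word (F.qx P) L) = 0 := by
  induction q with
  | zero => rw [word_zero]; exact (F.Q_super P R H).map_one
  | succ q ih =>
    rw [← Fin.cons_self_tail L, word_cons, (F.Q_super P R H).2, hx, ih]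
    simp

/-- The components of `dη = 0`. -/
def Closed {q : ℕ} (η : (Fin q → Fin n) → B) : Prop :=
  ∀ K : Fin (q + 1) → Fin n,
    ∑ r : Fin (q + 1), (-1 : B) ^ (r : ℕ) * F.δ (K r) (η (r.removeNth K)) = 0

/-- Cartan's formula after the substitution dxˡ ↦ Q xˡ. The first sum differentiates the substituted
factors. The rest is ∂ᵢH = d(ιᵢH), valid since dH = 0, and d becomes Q since Q annihilates every Q
xˡ. -/
lemma dx_mv_contr (hP : Alt P) (hH : Alt H) (hcl : F.Closed H)
    (hx : ∀ j, F.Q P R H (F.qx P j) = 0) (i : Fin n) :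
    F.dx i (F.mv (contr P H))
      = ∑ j, F.dx i (F.qx P j) * F.twist P H j + F.Q P R H (F.twist P H i) := by
  have h1 : ∑ L, F.o (H L) * F.dx i (word (F.qx P) L) = (p + 1 + 1) • ∑ j,
      ∑ L : Fin (p + 1) → Fin n, F.o (H (Fin.cons j L)) *
        (F.dx i (F.qx P j) * word (F.qx P) L) := by
    refine sum_mul_map_word (F.o : B →+* A) F.o_comm 1 (fun j g => ?_) (fun j k => ?_) hH
    · exact ((F.d_super (Sum.inl i)).2 _ _).trans (by simp [par, dx])
    · rw [one_smul, F.hom_one_anticomm (F.qx_hom P j) (F.dx_qx_hom hP i k)]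
  -- Closedness at the index `(i, L)`: the term r = 0 is the left side, the others carry the
  -- opposite sign.
  have h2 : ∀ L : Fin (p + 2) → Fin n, F.δ i (H L)
      = ∑ r : Fin (p + 2), (-1) ^ (r : ℕ) * F.δ (L r) (H (Fin.cons i (r.removeNth L))) := by
    intro L
    have := hcl (Fin.cons i L)
    rw [Fin.sum_univ_succ] at this
    simp only [Fin.val_zero, pow_zero, one_mul, Fin.cons_zero, Fin.val_succ, Fin.cons_succ,
      pow_succ, mul_neg, mul_one, neg_mul, Finset.sum_neg_distrib] at this
    rw [add_neg_eq_zero] at this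
    have h0 : ∀ r : Fin (p + 2), (r.succ.removeNth (Fin.cons i L : Fin (p + 3) → Fin n))
        = Fin.cons i (r.removeNth L) := by
      intro r
      funext t
      refine Fin.cases ?_ (fun t => ?_) t <;> simp [Fin.removeNth]
    simp only [h0] at this
    exact this
  have h3 : ∑ L, F.o (F.δ i (H L)) * word (F.qx P) L = (p + 1 + 1) • ∑ m,
      ∑ L : Fin (p + 1) → Fin n, F.o (F.δ m (H (Fin.cons i L))) *
        (F.qx P m * word (F.qx P) L) := by
    -- Every position r contributes the same: the sign (-1)^r is undone by moving the r-th factor of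
    -- the word to the front. This gives the factor p + 2.
    have h4 : ∀ r : Fin (p + 2), ∑ L, F.o ((-1) ^ (r : ℕ) *
        F.δ (L r) (H (Fin.cons i (r.removeNth L)))) * word (F.qx P) L
          = ∑ m, ∑ L : Fin (p + 1) → Fin n, F.o (F.δ m (H (Fin.cons i L))) *
        (F.qx P m * word (F.qx P) L) := by
      intro r
      rw [sum_insertNth r]
      refine Finset.sum_congr rfl fun m _ => Finset.sum_congr rfl fun L _ => ?_
      rw [word_insertNth fun j k => F.hom_one_anticomm (F.qx_hom P j) (F.qx_hom P k)]
      simp only [Fin.insertNth_apply_same, Fin.removeNth_insertNth, map_mul, map_pow, map_neg,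
        map_one]
      rcases neg_one_pow_eq_or A (r : ℕ) with h | h <;> simp [h]
    simp only [h2, map_sum, Finset.sum_mul]
    rw [Finset.sum_comm]
    simp only [h4, Finset.sum_const, Finset.card_univ, Fintype.card_fin]
  have h5 : F.dx i (F.mv (contr P H)) = (1 / ((p + 1 + 1).factorial : ℝ)) •
      (∑ L, F.o (F.δ i (H L)) * word (F.qx P) L + ∑ L, F.o (H L) * F.dx i (word (F.qx P) L)) := by
    rw [mv_contr, map_smul, map_sum, ← Finset.sum_add_distrib]
    congr 1
    refine Finset.sum_congr rfl fun L _ => ?_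
    rw [dx, d_o_mul, dx_o]
  have h6 : F.Q P R H (F.twist P H i) = (1 / ((p + 1).factorial : ℝ)) • ∑ m,
      ∑ L : Fin (p + 1) → Fin n, F.o (F.δ m (H (Fin.cons i L))) *
        (F.qx P m * word (F.qx P) L) := by
    rw [twist, mv_contr, map_smul, map_sum, Finset.sum_comm]
    congr 1
    refine Finset.sum_congr rfl fun L _ => ?_
    rw [(F.Q_super P R H).2, F.Q_word_qx hx, mul_zero, add_zero, Q_o, Finset.sum_mul]
    refine Finset.sum_congr rfl fun m _ => ?_
    rw [← F.o_comm, mul_assoc]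
  have h7 : ∑ j, F.dx i (F.qx P j) * F.twist P H j = (1 / ((p + 1).factorial : ℝ)) • ∑ j,
      ∑ L : Fin (p + 1) → Fin n, F.o (H (Fin.cons j L)) *
        (F.dx i (F.qx P j) * word (F.qx P) L) := by
    simp only [twist, mv_contr, mul_smul_comm, ← Finset.smul_sum, Finset.mul_sum]
    congr 1
    refine Finset.sum_congr rfl fun j _ => Finset.sum_congr rfl fun L _ => ?_
    rw [← mul_assoc, ← F.o_comm, mul_assoc]
  rw [h5, h3, h1, h6, h7, ← smul_add, factorial_smul, smul_add, add_comm]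

/-- This form and `qz_eq` replace components of P by derivatives of Q x and Q a, so that Q² can be
computed from commutation of Q with partial derivatives alone. -/
lemma qy_eq (hP : Alt P) (hR : Alt R) (i : Fin n) :
    F.qy P R i = ∑ j, (-((-1 : ℝ) ^ p • (F.da i (F.qx P j) * F.z j)) + F.da i (F.qa P j) * F.y j)
      + F.da i (F.mv R) := by
  rw [F.da_mv i hR, qy, Finset.sum_add_distrib, Finset.smul_sum, sub_eq_add_neg,
    ← Finset.sum_neg_distrib]
  congr 2
  · refine Finset.sum_congr rfl fun j _ => ?_
    rw [da_qx, hP.pair i j, map_neg, neg_mul, smul_neg, neg_neg]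
  · refine Finset.sum_congr rfl fun j _ => ?_
    rw [F.da_qa_eq hP, mv_one, neg_mul, Finset.sum_mul]
    rfl

lemma qz_eq (hP : Alt P) (i : Fin n) :
    F.qz P R H i = ∑ j, (-(F.dx i (F.qx P j) * F.z j)
        + (-1 : ℝ) ^ p • (F.dx i (F.qa P j) * F.y j))
      + (-1 : ℝ) ^ p • (F.dx i (F.mv R) + F.twist P H i) := by
  rw [qz, Finset.sum_add_distrib, sub_eq_add_neg, twist, dx_mv, ← mv_add]
  refine congrArg₂ _ (congrArg₂ _ ?_ ?_) ?_
  · refine Finset.sum_congr rfl fun j _ => ?_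
    rw [F.dx_qx_eq hP, neg_mul, neg_neg, mv_one, Finset.sum_mul]
    rfl
  · rw [← Finset.smul_sum, div_eq_mul_inv, mul_smul, ← smul_neg, Finset.smul_sum,
      ← Finset.sum_neg_distrib]
    congr 1
    refine Finset.sum_congr rfl fun j _ => ?_
    rw [F.dx_qa_eq, neg_mul, mv_two, smul_mul_assoc, one_div, Finset.sum_mul]
    congr 2
    refine Finset.sum_congr rfl fun k _ => ?_
    rw [Finset.sum_mul]
    refine Finset.sum_congr rfl fun l _ => ?_
    have h : IsHom F.s 2 (F.a k * F.a l) := (F.a_hom k).mul (F.a_hom l)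
    rw [mul_assoc, mul_assoc, mul_assoc, mul_assoc, ← F.hom_two_comm h, mul_assoc]
  · rw [mv, smul_smul]
    congr 1
    ring

lemma sum_mul_qz (hP : Alt P) (u : Fin n → A) :
    ∑ j, u j * F.qz P R H j
      = - dsum u (fun j k => F.dx j (F.qx P k)) F.z
        + (-1 : ℝ) ^ p • dsum u (fun j k => F.dx j (F.qa P k)) F.y
        + ((-1 : ℝ) ^ p • ∑ j, u j * F.dx j (F.mv R)
          + (-1 : ℝ) ^ p • ∑ j, u j * F.twist P H j) := by
  have := sum_mul_sum_add u (fun j k => F.dx j (F.qx P k)) (fun j k => F.dx j (F.qa P k)) F.z F.y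
    (fun j => (-1 : ℝ) ^ p • (F.dx j (F.mv R) + F.twist P H j)) (-1) ((-1) ^ p)
  simp only [neg_one_smul, ← F.qz_eq hP] at this
  rw [this]
  simp only [mul_smul_comm, mul_add, smul_add, Finset.sum_add_distrib, Finset.smul_sum]

lemma sum_mul_qy (hP : Alt P) (hR : Alt R) (u : Fin n → A) :
    ∑ j, u j * F.qy P R j
      = - ((-1 : ℝ) ^ p • dsum u (fun j k => F.da j (F.qx P k)) F.z)
        + dsum u (fun j k => F.da j (F.qa P k)) F.y + ∑ j, u j * F.da j (F.mv R) := by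
  have := sum_mul_sum_add u (fun j k => F.da j (F.qx P k)) (fun j k => F.da j (F.qa P k)) F.z F.y
    (fun j => F.da j (F.mv R)) (-(-1) ^ p) 1
  simpa only [neg_smul, one_smul, ← F.qy_eq hP hR] using this

/-- As Q kills Q x and Q a, commuting Q with ∂/∂aᵢ expresses Q of their a-derivatives by products of
first derivatives. The terms linear in y and z then cancel, and only those with ρ and H survive. -/
lemma Q_qy (hP : Alt P) (hR : Alt R) (hH : Alt H) (hx : ∀ j, F.Q P R H (F.qx P j) = 0)
    (ha : ∀ j, F.Q P R H (F.qa P j) = 0) (i : Fin n) :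
    F.Q P R H (F.qy P R i) = - F.da i (F.Q P R H (F.mv R) + F.mv (contr P H)) := by
  have hdx : ∀ j, F.Q P R H (F.da i (F.qx P j))
      = ∑ k, (F.da i (F.qx P k) * F.dx k (F.qx P j) + F.da i (F.qa P k) * F.da k (F.qx P j)) := by
    intro j
    have := da_Q P R H (F.noYZ_qx hP j) i
    rw [hx, map_zero] at this
    exact (sub_eq_zero.1 this.symm).symm
  have hda : ∀ j, F.Q P R H (F.da i (F.qa P j))
      = ∑ k, (F.da i (F.qx P k) * F.dx k (F.qa P j) + F.da i (F.qa P k) * F.da k (F.qa P j)) := by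
    intro j
    have := da_Q P R H (F.noYZ_qa (P := P) j) i
    rw [ha, map_zero] at this
    exact (sub_eq_zero.1 this.symm).symm
  have h1 : ∀ j, F.Q P R H (F.da i (F.qx P j) * F.z j)
      = F.Q P R H (F.da i (F.qx P j)) * F.z j + F.da i (F.qx P j) * F.qz P R H j := by
    intro j
    rw [F.Q_mul P R H 0 (by rw [da_qx]; exact F.o_hom _), Q_z, pow_zero, one_smul]
  have h2 : ∀ j, F.Q P R H (F.da i (F.qa P j) * F.y j)
      = F.Q P R H (F.da i (F.qa P j)) * F.y j - F.da i (F.qa P j) * F.qy P R j := by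
    intro j
    rw [F.Q_mul P R H 1 (F.da_qa_hom hP i j), Q_y, pow_one, neg_one_smul, sub_eq_add_neg]
  have e1 := F.sum_mul_qz (R := R) (H := H) hP fun j => F.da i (F.qx P j)
  have e2 := F.sum_mul_qy hP hR fun j => F.da i (F.qa P j)
  have e3 := sum_sum_mul (fun k => F.da i (F.qx P k)) (fun k => F.da i (F.qa P k))
    (fun k j => F.dx k (F.qx P j)) (fun k j => F.da k (F.qx P j)) F.z
  have e4 := sum_sum_mul (fun k => F.da i (F.qx P k)) (fun k => F.da i (F.qa P k))
    (fun k j => F.dx k (F.qa P j)) (fun k j => F.da k (F.qa P j)) F.y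
  simp only [← hdx, ← hda] at e3 e4
  rw [F.qy_eq hP hR, map_add, map_add, map_sum, F.da_mv_contr hH, da_Q P R H (F.noYZ_mv R) i]
  simp only [map_add, map_neg, map_smul, h1, h2, smul_add, Finset.sum_add_distrib,
    Finset.sum_neg_distrib, Finset.sum_sub_distrib, ← Finset.smul_sum, e1, e2, e3, e4]
  -- For either sign (-1)^p the double sums, treated as atoms, cancel in pairs.
  rcases neg_one_pow_eq_or ℝ p with h | h <;> simp only [h, neg_smul, one_smul] <;> abel

/-- The same cancellation with ∂/∂xⁱ. The extra term Q(twist_i) coming from Q zᵢ is accounted for by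
`dx_mv_contr`, where dH = 0 is needed. -/
lemma Q_qz (hP : Alt P) (hR : Alt R) (hH : Alt H) (hcl : F.Closed H)
    (hx : ∀ j, F.Q P R H (F.qx P j) = 0) (ha : ∀ j, F.Q P R H (F.qa P j) = 0) (i : Fin n) :
    F.Q P R H (F.qz P R H i)
      = (-1 : ℝ) ^ p • F.dx i (F.Q P R H (F.mv R) + F.mv (contr P H)) := by
  have hdx : ∀ j, ∑ k, (F.dx i (F.qx P k) * F.dx k (F.qx P j)
        + F.dx i (F.qa P k) * F.da k (F.qx P j))
      = - F.Q P R H (F.dx i (F.qx P j)) := by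
    intro j
    have := dx_Q P R H (F.noYZ_qx hP j) i
    rw [hx, map_zero] at this
    exact eq_neg_of_add_eq_zero_left this.symm
  have hda : ∀ j, ∑ k, (F.dx i (F.qx P k) * F.dx k (F.qa P j)
        + F.dx i (F.qa P k) * F.da k (F.qa P j))
      = - F.Q P R H (F.dx i (F.qa P j)) := by
    intro j
    have := dx_Q P R H (F.noYZ_qa (P := P) j) i
    rw [ha, map_zero] at this
    exact eq_neg_of_add_eq_zero_left this.symm
  have h1 : ∀ j, F.Q P R H (F.dx i (F.qx P j) * F.z j)
      = F.Q P R H (F.dx i (F.qx P j)) * F.z j - F.dx i (F.qx P j) * F.qz P R H j := by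
    intro j
    rw [F.Q_mul P R H 1 (F.dx_qx_hom hP i j), Q_z, pow_one, neg_one_smul, sub_eq_add_neg]
  have h2 : ∀ j, F.Q P R H (F.dx i (F.qa P j) * F.y j)
      = F.Q P R H (F.dx i (F.qa P j)) * F.y j + F.dx i (F.qa P j) * F.qy P R j := by
    intro j
    rw [F.Q_mul P R H 2 (F.dx_qa_hom i j), Q_y, neg_one_sq, one_smul]
  have e1 := F.sum_mul_qz (R := R) (H := H) hP fun j => F.dx i (F.qx P j)
  have e2 := F.sum_mul_qy hP hR fun j => F.dx i (F.qa P j)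
  have e3 := sum_sum_mul (fun k => F.dx i (F.qx P k)) (fun k => F.dx i (F.qa P k))
    (fun k j => F.dx k (F.qx P j)) (fun k j => F.da k (F.qx P j)) F.z
  have e4 := sum_sum_mul (fun k => F.dx i (F.qx P k)) (fun k => F.dx i (F.qa P k))
    (fun k j => F.dx k (F.qa P j)) (fun k j => F.da k (F.qa P j)) F.y
  simp only [hdx, hda, neg_mul, Finset.sum_neg_distrib] at e3 e4
  rw [neg_eq_iff_eq_neg] at e3 e4
  rw [F.qz_eq hP, map_add, map_add, map_sum, F.dx_mv_contr hP hH hcl hx,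
    dx_Q P R H (F.noYZ_mv R) i]
  simp only [map_add, map_neg, map_smul, h1, h2, smul_add, Finset.sum_add_distrib,
    Finset.sum_neg_distrib, Finset.sum_sub_distrib, ← Finset.smul_sum, e1, e2, e3, e4]
  rcases neg_one_pow_eq_or ℝ p with h | h <;> simp only [h, neg_smul, one_smul] <;> abel

/-- The square of `Q` vanishes iff `P` is Poisson and the twisted bracket condition holds. -/
theorem Q_sq_eq_zero_iff (hP : Alt P) (hR : Alt R) (hH : Alt H) (hcl : F.Closed H) :
    (∀ f, F.Q P R H (F.Q P R H f) = 0) ↔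
      (∀ K, F.sch (q := 1) P P K = 0) ∧ ∀ K, F.sch P R K + contr P H K = 0 := by
  have hA : Alt (F.sch (q := 1) P P) := F.sch_alt P P
  have hB : Alt fun K => F.sch P R K + contr P H K := (F.sch_alt P R).add (contr_alt hH)
  have hB' : F.Q P R H (F.mv R) + F.mv (contr P H)
      = F.mv fun K => F.sch P R K + contr P H K := by
    rw [F.mv_add, F.Q_mv hR]
  constructor
  · intro h
    have hx : ∀ j, F.Q P R H (F.qx P j) = 0 := fun j => by rw [← F.Q_X P R H, h]
    have ha : ∀ j, F.Q P R H (F.qa P j) = 0 := fun j => by rw [← F.Q_a P R H, h]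
    refine ⟨fun K => ?_, fun K => ?_⟩
    -- Only the derivative of Qπ in a with the index `K 0` is known to vanish; its components are
    -- those of the bracket with first index `K 0`.
    · rw [← Fin.cons_self_tail K]
      refine F.mv_eq_zero (hA.cons (K 0)) ?_ _
      have := F.Q_qx (R := R) (H := H) hP (K 0)
      rw [hx, F.Q_mv hP, F.da_mv _ hA] at this
      exact (smul_eq_zero.1 this.symm).resolve_left (by norm_num)
    · rw [← Fin.cons_self_tail K]
      refine F.mv_eq_zero (hB.cons (K 0)) ?_ _
      have := F.Q_qy hP hR hH hx ha (K 0)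
      rw [← F.Q_y P R H, h, hB', F.da_mv _ hB] at this
      exact neg_eq_zero.1 this.symm
  · rintro ⟨h1, h2⟩ f
    have hpi : F.Q P R H (F.mv P) = 0 := by
      rw [F.Q_mv hP, funext h1, mv_zero]
    have hrho : F.Q P R H (F.mv R) + F.mv (contr P H) = 0 := by
      rw [hB', funext h2, mv_zero]
    have hx : ∀ j, F.Q P R H (F.qx P j) = 0 := fun j => by
      rw [F.Q_qx hP, hpi, map_zero, smul_zero]
    have ha : ∀ j, F.Q P R H (F.qa P j) = 0 := fun j => by
      rw [F.Q_qa hP, hpi, map_zero, smul_zero]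
    have h := vf_vf F.s_s (F.coef_hom P R H) F.d_super F.d_comm f
    refine h.trans (Finset.sum_eq_zero fun i _ => ?_)
    have : F.Q P R H (F.coef P R H i) = 0 := by
      rcases i with i | i | i | i
      · exact hx i
      · exact ha i
      · exact (F.Q_qy hP hR hH hx ha i).trans (by rw [hrho, map_zero, neg_zero])
      · exact (F.Q_qz hP hR hH hcl hx ha i).trans (by rw [hrho, map_zero, smul_zero])
    exact (congrArg (· * _) this).trans (zero_mul _)

/-! ### Degrees -/

/-- The weights of the coordinates `a, y, z`. -/
def wt (p : ℕ) : Fin n ⊕ Fin n ⊕ Fin n → ℝ :=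
  Sum.elim (fun _ => 1) (Sum.elim (fun _ => (p : ℝ) - 1) fun _ => p)

/-- The Euler vector field. -/
def eu : A →ₗ[ℝ] A :=
  ∑ j, wt p j • (LinearMap.mulLeft ℝ (F.ξ j) ∘ₗ F.d (Sum.inr j))

/-- `f` has degree `r`. -/
def Deg (r : ℝ) (f : A) : Prop := F.eu f = r • f

variable {F}

lemma eu_super : IsSuper F.s 0 F.eu :=
  IsSuper.sum fun j _ => IsSuper.smul _ ((IsSuper.mulLeft (F.ξ_hom j) (F.d_super _)).congr F.s_s
    (by omega))

lemma Deg.mul {r t : ℝ} {f g : A} (hf : F.Deg r f) (hg : F.Deg t g) : F.Deg (r + t) (f * g) := by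
  unfold Deg at *
  rw [eu_super.2, hf, pow_zero, AlgHom.one_apply, hg, smul_mul_assoc, mul_smul_comm, add_smul]

lemma Deg.add {r : ℝ} {f g : A} (hf : F.Deg r f) (hg : F.Deg r g) : F.Deg r (f + g) := by
  unfold Deg at *
  rw [map_add, hf, hg, smul_add]

lemma Deg.smul {r : ℝ} (t : ℝ) {f : A} (hf : F.Deg r f) : F.Deg r (t • f) := by
  unfold Deg at *
  rw [map_smul, hf, smul_comm]

lemma Deg.sub {r : ℝ} {f g : A} (hf : F.Deg r f) (hg : F.Deg r g) : F.Deg r (f - g) := by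
  unfold Deg at *
  rw [map_sub, hf, hg, smul_sub]

lemma Deg.sum {r : ℝ} {ι : Type*} {t : Finset ι} {f : ι → A} (h : ∀ i ∈ t, F.Deg r (f i)) :
    F.Deg r (∑ i ∈ t, f i) :=
  Finset.sum_induction _ _ (fun _ _ => Deg.add) (by simp [Deg]) h

variable (F)

lemma deg_o (b : B) : F.Deg 0 (F.o b) := by
  simp [Deg, eu, LinearMap.sum_apply, dξ_o]

lemma deg_ξ (j : Fin n ⊕ Fin n ⊕ Fin n) : F.Deg (wt p j) (F.ξ j) := by
  simp only [Deg, eu, LinearMap.sum_apply, LinearMap.smul_apply, LinearMap.comp_apply,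
    LinearMap.mulLeft_apply, d_ξ, Sum.inr.injEq]
  simp

lemma deg_o_mul (b : B) {r : ℝ} {f : A} (hf : F.Deg r f) : F.Deg r (F.o b * f) := by
  simpa using (F.deg_o b).mul hf

lemma deg_a (i : Fin n) : F.Deg 1 (F.a i) := F.deg_ξ (Sum.inl i)
lemma deg_y (i : Fin n) : F.Deg ((p : ℝ) - 1) (F.y i) := F.deg_ξ (Sum.inr (Sum.inl i))
lemma deg_z (i : Fin n) : F.Deg (p : ℝ) (F.z i) := F.deg_ξ (Sum.inr (Sum.inr i))

lemma deg_word {q : ℕ} (K : Fin q → Fin n) : F.Deg q (word F.a K) := by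
  induction q with
  | zero =>
    rw [word_zero, Deg, eu_super.map_one]; simp
  | succ q ih =>
    rw [← Fin.cons_self_tail K, word_cons]
    have := (F.deg_a (K 0)).mul (ih (Fin.tail K))
    rwa [add_comm, ← Nat.cast_succ] at this

/-- The weights of all coordinates. -/
def wtAll (p : ℕ) : Fin n ⊕ Fin n ⊕ Fin n ⊕ Fin n → ℝ := Sum.elim (fun _ => 0) (wt p)

lemma deg_coef (i : Fin n ⊕ Fin n ⊕ Fin n ⊕ Fin n) :
    F.Deg (wtAll p i + 1) (F.coef P R H i) := by
  have e : ∀ {r t : ℝ} {f : A}, F.Deg r f → r = t → F.Deg t f := fun h e => e ▸ h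
  rcases i with i | i | i | i <;> simp only [coef, wtAll, wt, Sum.elim_inl, Sum.elim_inr]
  · exact Deg.sum fun j _ => e (F.deg_o_mul _ (F.deg_a j)) (by ring)
  · refine Deg.smul _ (Deg.sum fun j _ => Deg.sum fun k _ => ?_)
    exact (F.deg_o_mul _ (F.deg_a j)).mul (F.deg_a k)
  · refine Deg.add (Deg.sub (Deg.smul _ (Deg.sum fun j _ => ?_))
      (Deg.sum fun j _ => Deg.sum fun k _ => ?_)) (Deg.smul _ (Deg.sum fun J _ => ?_))
    · exact e (F.deg_o_mul _ (F.deg_z j)) (by ring)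
    · exact e ((F.deg_o_mul _ (F.deg_a k)).mul (F.deg_y j)) (by ring)
    · exact e (F.deg_o_mul _ (F.deg_word J)) (by ring)
  · refine Deg.add (Deg.sub (Deg.sum fun j _ => Deg.sum fun k _ => ?_)
      (Deg.smul _ (Deg.sum fun j _ => Deg.sum fun k _ => Deg.sum fun l _ => ?_)))
      (Deg.smul _ (Deg.sum fun K _ => ?_))
    · exact e ((F.deg_o_mul _ (F.deg_a k)).mul (F.deg_z j)) (by ring)
    · exact e (((F.deg_o_mul _ (F.deg_y j)).mul (F.deg_a k)).mul (F.deg_a l)) (by ring)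
    · exact e (F.deg_o_mul _ (F.deg_word K)) (by push_cast; ring)

/-- A partial derivative lowers the degree by the weight of its coordinate; the coefficients of Q
exceed that weight by one. -/
lemma eu_d (i : Fin n ⊕ Fin n ⊕ Fin n ⊕ Fin n) (f : A) :
    F.eu (F.d i f) = F.d i (F.eu f) - wtAll p i • F.d i f := by
  have h : ∀ j, F.d i (F.ξ j * F.d (Sum.inr j) f)
      = (if i = Sum.inr j then F.d (Sum.inr j) f else 0)
        + F.ξ j * F.d (Sum.inr j) (F.d i f) := by
    intro j
    rw [(F.d_super i).2, d_ξ, (F.ξ_hom j).pow_apply, F.d_comm i, smul_mul_smul_comm, ← mul_pow]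
    simp
  simp only [eu, LinearMap.sum_apply, LinearMap.smul_apply, LinearMap.comp_apply,
    LinearMap.mulLeft_apply, map_sum, map_smul, h, smul_add, Finset.sum_add_distrib]
  have h' : ∑ j, wt p j • (if i = Sum.inr j then F.d (Sum.inr j) f else 0)
      = wtAll p i • F.d i f := by
    rcases i with i | i
    · simp [wtAll]
    · simp only [Sum.inr.injEq]
      rw [Finset.sum_eq_single i (fun j _ hj => by simp [Ne.symm hj]) (by simp)]
      simp [wtAll]
  rw [h']
  abel

/-- `Q` raises the degree by one. -/
lemma deg_Q {r : ℝ} {f : A} (hf : F.Deg r f) : F.Deg (r + 1) (F.Q P R H f) := by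
  unfold Q
  rw [vf_apply]
  refine Deg.sum fun i _ => ?_
  have h : F.Deg (r - wtAll p i) (F.d i f) := by
    unfold Deg at *
    rw [eu_d, hf, map_smul, sub_smul]
  have := (F.deg_coef (P := P) (R := R) (H := H) i).mul h
  rwa [show wtAll p i + 1 + (r - wtAll p i) = r + 1 by ring] at this

end Frame

/-! ### The Grassmann algebra -/

section Grassmann

variable {V : Type*} [AddCommGroup V] [Module ℝ V] {Q : QuadraticForm ℝ V}

open CliffordAlgebra in
lemma contractLeft_mul (d : Module.Dual ℝ V) (a b : CliffordAlgebra Q) :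
    contractLeft d (a * b) = contractLeft d a * b + involute a * contractLeft d b := by
  induction a using CliffordAlgebra.left_induction with
  | algebraMap r => simp [contractLeft_algebraMap_mul, contractLeft_algebraMap]
  | add x y hx hy => simp only [add_mul, map_add, hx, hy]; abel
  | ι_mul x m hx =>
    rw [mul_assoc, contractLeft_ι_mul, hx, contractLeft_ι_mul]
    simp only [map_mul, involute_ι, mul_add, sub_mul, mul_assoc, smul_mul_assoc, neg_mul]
    abel

open CliffordAlgebra in
lemma involute_contractLeft (d : Module.Dual ℝ V) (a : CliffordAlgebra Q) :
    involute (contractLeft d a) = - contractLeft d (involute a) := by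
  induction a using CliffordAlgebra.left_induction with
  | algebraMap r => simp [contractLeft_algebraMap]
  | add x y hx hy => simp only [map_add, hx, hy]; abel
  | ι_mul x m hx =>
    simp only [contractLeft_ι_mul, map_sub, map_smul, map_mul, involute_ι, hx, neg_mul, map_neg,
      mul_neg]
    abel

/-- Makes the odd coordinates supercommute with every superfunction. It rests on the anticommutation
of generators, so it is specific to the exterior algebra. -/
lemma ι_mul_eq (v : V) (y : ExteriorAlgebra ℝ V) :
    ExteriorAlgebra.ι ℝ v * y = CliffordAlgebra.involute y * ExteriorAlgebra.ι ℝ v := by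
  induction y using CliffordAlgebra.left_induction with
  | algebraMap r => simp [Algebra.commutes]
  | add x y hx hy => simp only [map_add, add_mul, mul_add, hx, hy]
  | ι_mul y m hy =>
    have h : ExteriorAlgebra.ι ℝ v * ExteriorAlgebra.ι ℝ m
        = - (ExteriorAlgebra.ι ℝ m * ExteriorAlgebra.ι ℝ v) :=
      eq_neg_of_add_eq_zero_left (ExteriorAlgebra.ι_add_mul_swap v m)
    change ExteriorAlgebra.ι ℝ v * (ExteriorAlgebra.ι ℝ m * y) = _
    rw [← mul_assoc, h, neg_mul, mul_assoc, hy, map_mul, CliffordAlgebra.involute_ι, neg_mul,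
      neg_mul, mul_assoc]

end Grassmann

/-! ### Smooth functions on the body -/

section Body

variable {n : ℕ} {U : Opens (E n)}

/-- The body is open, so the values of the extension outside it do not affect derivatives at its
points. -/
lemma extend_eventuallyEq {f : BodyFun U} {g : E n × E n → ℝ} (w : body U)
    (h : ∀ v : body U, f v = g v) : extend f =ᶠ[nhds (w : E n × E n)] g := by
  filter_upwards [(body U).isOpen.mem_nhds w.2] with v hv
  exact (extend_apply f ⟨v, hv⟩).trans (h ⟨v, hv⟩)

lemma dirDeriv_apply_of_eq {f : BodyFun U} {g : E n × E n → ℝ} (v : E n × E n) (w : body U)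
    (h : ∀ v : body U, f v = g v) : dirDeriv v f w = fderiv ℝ g w v := by
  change fderiv ℝ (extend f) w v = _
  rw [(extend_eventuallyEq w h).fderiv_eq]

lemma dirDeriv_apply (v : E n × E n) (f : BodyFun U) (w : body U) :
    dirDeriv v f w = fderiv ℝ (extend f) w v := rfl

lemma dirDeriv_mul (v : E n × E n) (f g : BodyFun U) :
    dirDeriv v (f * g) = dirDeriv v f * g + f * dirDeriv v g := by
  ext w
  rw [dirDeriv_apply_of_eq (g := extend f * extend g) v w fun v => by
    simp [extend_apply], fderiv_mul ((contDiffAt_extend f w).differentiableAt (by simp))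
      ((contDiffAt_extend g w).differentiableAt (by simp))]
  simp only [ContMDiffMap.coe_add, ContMDiffMap.coe_mul, Pi.add_apply, Pi.mul_apply,
    dirDeriv_apply, extend_apply]
  simp only [add_apply, smul_apply, smul_eq_mul]
  ring

lemma dirDeriv_comm (v v' : E n × E n) (f : BodyFun U) :
    dirDeriv v (dirDeriv v' f) = dirDeriv v' (dirDeriv v f) := by
  ext w
  have key : ∀ v v' : E n × E n, dirDeriv v (dirDeriv v' f) w
      = fderiv ℝ (fderiv ℝ (extend f)) w v v' := by
    intro v v'
    rw [dirDeriv_apply_of_eq (g := fun w => fderiv ℝ (extend f) w v') v w fun _ => rfl,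
      fderiv_clm_apply (((contDiffAt_extend f w).fderiv_right (m := 1)
        (by norm_cast)).differentiableAt (by simp)) (by fun_prop)]
    simp
  rw [key, key]
  exact ((contDiffAt_extend f w).isSymmSndFDerivAt
    (by simp only [minSmoothness_of_isRCLikeNormedField]; norm_cast)).eq v v'

lemma dirDeriv_one (v : E n × E n) : dirDeriv v (1 : BodyFun U) = 0 := by
  have := dirDeriv_mul v (1 : BodyFun U) 1
  simpa using this

end Body

/-! ### Superfunctions -/

section Superfunctions

variable {n : ℕ} {U : Opens (E n)}

/-- The parity involution as an algebra homomorphism. -/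
noncomputable def parityHom : SuperFun U →ₐ[ℝ] SuperFun U :=
  Algebra.TensorProduct.map (AlgHom.id ℝ (BodyFun U))
    (CliffordAlgebra.involute (Q := (0 : QuadraticForm ℝ (Fin n ⊕ Fin n → ℝ))))

lemma parityHom_tmul (f : BodyFun U) (g : Grassmann n) :
    parityHom (f ⊗ₜ[ℝ] g) = f ⊗ₜ[ℝ] (CliffordAlgebra.involute g : Grassmann n) := rfl

lemma parityHom_parityHom (f : SuperFun U) : parityHom (parityHom f) = f := by
  induction f using TensorProduct.induction_on with
  | zero => simp
  | add x y hx hy => rw [map_add, map_add, hx, hy]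
  | tmul f g => rw [parityHom_tmul, parityHom_tmul, CliffordAlgebra.involute_involute]

lemma isHom_ofBody (f : BodyFun U) : IsHom parityHom 0 (ofBody f) := by
  refine ⟨?_, fun g => ?_⟩
  · simp [ofBody, parityHom_tmul]
  · rw [pow_zero, AlgHom.one_apply]
    induction g using TensorProduct.induction_on with
    | zero => simp
    | add x y hx hy => rw [mul_add, add_mul, hx, hy]
    | tmul g a => simp [ofBody, mul_comm]

lemma isHom_evenCoord (i : Fin n) : IsHom parityHom 0 (evenCoord i : SuperFun U) := isHom_ofBody _

lemma isHom_oddCoord (j : Fin n ⊕ Fin n) : IsHom parityHom 1 (oddCoord j : SuperFun U) := by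
  refine ⟨?_, fun g => ?_⟩
  · rw [oddCoord, parityHom_tmul, ExteriorAlgebra.ι, CliffordAlgebra.involute_ι]
    rw [TensorProduct.tmul_neg, pow_one]
    exact (neg_one_smul ℝ _).symm
  · rw [pow_one]
    induction g using TensorProduct.induction_on with
    | zero => simp
    | add x y hx hy => rw [mul_add, map_add, add_mul, hx, hy]
    | tmul g a =>
      rw [parityHom_tmul, oddCoord, Algebra.TensorProduct.tmul_mul_tmul,
        Algebra.TensorProduct.tmul_mul_tmul, ι_mul_eq, mul_comm]

lemma isSuper_rTensor (v : E n × E n) :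
    IsSuper (parityHom (U := U)) 0 (LinearMap.rTensor (Grassmann n) (dirDeriv v)) := by
  refine ⟨fun f => ?_, fun f g => ?_⟩
  · rw [pow_zero, one_smul]
    induction f using TensorProduct.induction_on with
    | zero => simp
    | add x y hx hy => simp only [map_add, hx, hy]
    | tmul f a => rfl
  · rw [pow_zero, AlgHom.one_apply]
    induction f using TensorProduct.induction_on with
    | zero => simp
    | add x y hx hy => simp only [map_add, add_mul, hx, hy]; abel
    | tmul f a =>
      induction g using TensorProduct.induction_on with
      | zero => simp
      | add x y hx hy => simp only [map_add, mul_add, hx, hy]; abel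
      | tmul g b =>
        simp only [Algebra.TensorProduct.tmul_mul_tmul, LinearMap.rTensor_tmul, dirDeriv_mul,
          TensorProduct.add_tmul]

lemma isSuper_dOdd (j : Fin n ⊕ Fin n) :
    IsSuper (parityHom (U := U)) 1 (dOdd j) := by
  refine ⟨fun f => ?_, fun f g => ?_⟩
  · induction f using TensorProduct.induction_on with
    | zero => simp
    | add x y hx hy => simp only [map_add, hx, hy, smul_add]
    | tmul f a =>
      rw [dOdd, LinearMap.lTensor_tmul, parityHom_tmul, parityHom_tmul, LinearMap.lTensor_tmul,
        involute_contractLeft, TensorProduct.tmul_neg, pow_one]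
      exact (neg_one_smul ℝ _).symm
  · rw [pow_one]
    induction f using TensorProduct.induction_on with
    | zero => simp
    | add x y hx hy => simp only [map_add, add_mul, hx, hy]; abel
    | tmul f a =>
      induction g using TensorProduct.induction_on with
      | zero => simp
      | add x y hx hy => simp only [map_add, mul_add, hx, hy]; abel
      | tmul g b =>
        simp only [dOdd, Algebra.TensorProduct.tmul_mul_tmul, LinearMap.lTensor_tmul,
          parityHom_tmul, contractLeft_mul, TensorProduct.tmul_add]

lemma rTensor_comm (v v' : E n × E n) (f : SuperFun U) :
    LinearMap.rTensor (Grassmann n) (dirDeriv v) (LinearMap.rTensor (Grassmann n) (dirDeriv v') f)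
      = LinearMap.rTensor (Grassmann n) (dirDeriv v')
        (LinearMap.rTensor (Grassmann n) (dirDeriv v) f) := by
  induction f using TensorProduct.induction_on with
  | zero => simp
  | add x y hx hy => simp only [map_add, hx, hy]
  | tmul f a => simp only [LinearMap.rTensor_tmul, dirDeriv_comm v v']

lemma rTensor_dOdd (v : E n × E n) (j : Fin n ⊕ Fin n) (f : SuperFun U) :
    LinearMap.rTensor (Grassmann n) (dirDeriv v) (dOdd j f)
      = dOdd j (LinearMap.rTensor (Grassmann n) (dirDeriv v) f) := by
  induction f using TensorProduct.induction_on with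
  | zero => simp
  | add x y hx hy => simp only [map_add, hx, hy]
  | tmul f a => rfl

lemma dOdd_dOdd (i j : Fin n ⊕ Fin n) (f : SuperFun U) :
    dOdd i (dOdd j f) = - dOdd j (dOdd i f) := by
  induction f using TensorProduct.induction_on with
  | zero => simp
  | add x y hx hy => simp only [map_add, hx, hy, neg_add]
  | tmul f a =>
    simp only [dOdd, LinearMap.lTensor_tmul]
    rw [CliffordAlgebra.contractLeft_comm, TensorProduct.tmul_neg]

lemma dOdd_ofBody (j : Fin n ⊕ Fin n) (f : BodyFun U) : dOdd j (ofBody f) = 0 := by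
  simp [dOdd, ofBody, CliffordAlgebra.contractLeft_one]

lemma dOdd_oddCoord (i j : Fin n ⊕ Fin n) :
    dOdd i (oddCoord j : SuperFun U) = if i = j then 1 else 0 := by
  rw [dOdd, oddCoord, LinearMap.lTensor_tmul, ExteriorAlgebra.ι, CliffordAlgebra.contractLeft_ι]
  by_cases h : i = j
  · subst h; simp [Algebra.TensorProduct.one_def]
  · simp [h]

lemma rTensor_oddCoord (v : E n × E n) (j : Fin n ⊕ Fin n) :
    LinearMap.rTensor (Grassmann n) (dirDeriv v) (oddCoord j : SuperFun U) = 0 := by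
  rw [oddCoord, LinearMap.rTensor_tmul, dirDeriv_one, TensorProduct.zero_tmul]

lemma rTensor_ofBody (v : E n × E n) (f : BodyFun U) :
    LinearMap.rTensor (Grassmann n) (dirDeriv v) (ofBody f) = ofBody (dirDeriv v f) := rfl

lemma rTensor_evenCoord (v : E n × E n) (i : Fin n) :
    LinearMap.rTensor (Grassmann n) (dirDeriv v) (evenCoord i : SuperFun U)
      = algebraMap ℝ _ (v.2 i) := by
  have h : dirDeriv v (ofContDiffAt (fun w => w.2 i) (contDiffAt_fibre i) : BodyFun U)
      = (v.2 i) • (1 : BodyFun U) := by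
    ext w
    rw [dirDeriv_apply_of_eq
      (g := ((EuclideanSpace.proj i : E n →L[ℝ] ℝ).comp (ContinuousLinearMap.snd ℝ (E n) (E n))))
      v w fun _ => rfl, ContinuousLinearMap.fderiv]
    simp
  rw [evenCoord, rTensor_ofBody, h, ofBody, ← TensorProduct.smul_tmul',
    Algebra.algebraMap_eq_smul_one,
    Algebra.TensorProduct.one_def]

/-- Setting the odd coordinates to zero is a left inverse of `ofBody`. -/
lemma ofBody_eq_zero {f : BodyFun U} (h : ofBody f = 0) : f = 0 := by
  have := congrArg (Algebra.TensorProduct.map (AlgHom.id ℝ (BodyFun U))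
    (ExteriorAlgebra.algebraMapInv (R := ℝ) (M := Fin n ⊕ Fin n → ℝ))) h
  rw [ofBody, Algebra.TensorProduct.map_tmul, map_zero, map_one] at this
  have := congrArg (Algebra.TensorProduct.rid ℝ ℝ (BodyFun U)) this
  simpa using this

end Superfunctions

end RPoisson

/-! ### The superfunctions over a coordinate domain form a frame -/

noncomputable section

namespace RPoisson

section Superframe

variable {n : ℕ} {U : Opens (E n)}

/-- The functions on the body that do not depend on the fibre coordinates. -/
def baseFun (U : Opens (E n)) : Subalgebra ℝ (BodyFun U) where
  carrier := {f | ∀ i, dirDeriv (0, EuclideanSpace.single i 1) f = 0}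
  mul_mem' {f g} hf hg i := by rw [dirDeriv_mul, hf i, hg i, zero_mul, mul_zero, add_zero]
  add_mem' {f g} hf hg i := by rw [map_add, hf i, hg i, add_zero]
  algebraMap_mem' r i := by
    rw [Algebra.algebraMap_eq_smul_one, map_smul, dirDeriv_one, smul_zero]

/-- The partial derivatives on base functions. -/
def dBase (i : Fin n) : baseFun U →ₗ[ℝ] baseFun U where
  toFun f := ⟨bX i f, fun j => by rw [bX, dirDeriv_comm, f.2 j, map_zero]⟩
  map_add' f g := Subtype.ext (map_add (bX i) _ _)
  map_smul' r f := Subtype.ext (map_smul (bX i) _ _)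

lemma ofBase_mem {g : E n → ℝ} (hg : ContDiffOn ℝ ∞ g (U : Set (E n))) :
    ofBase g hg ∈ baseFun U := by
  intro i
  ext w
  rw [dirDeriv_apply_of_eq (g := g ∘ Prod.fst) _ w fun _ => rfl,
    fderiv_comp _ ((hg.contDiffAt (U.isOpen.mem_nhds w.2.1)).differentiableAt (by simp))
      differentiableAt_fst]
  simp [fderiv_fst]

lemma bX_ofBase_apply {g : E n → ℝ} (hg : ContDiffOn ℝ ∞ g (U : Set (E n))) (i : Fin n)
    (w : body U) : bX i (ofBase g hg) w = pd i g (w : E n × E n).1 := by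
  rw [bX, dirDeriv_apply_of_eq (g := g ∘ Prod.fst) _ w fun _ => rfl,
    fderiv_comp _ ((hg.contDiffAt (U.isOpen.mem_nhds w.2.1)).differentiableAt (by simp))
      differentiableAt_fst]
  simp [fderiv_fst, pd]

/-- The partial derivatives with respect to `x, a, y, z`. -/
def dCoord (U : Opens (E n)) (p : ℕ) :
    Fin n ⊕ Fin n ⊕ Fin n ⊕ Fin n → SuperFun U →ₗ[ℝ] SuperFun U :=
  Sum.elim dX (Sum.elim dA (Sum.elim (dY p) (dZ p)))

/-- The coordinates `a, y, z`. -/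
def cCoord (U : Opens (E n)) (p : ℕ) : Fin n ⊕ Fin n ⊕ Fin n → SuperFun U :=
  Sum.elim ca (Sum.elim (cy p) (cz p))

/-- Reduces the sign rules, for both parities of p, to two kinds of operator: a directional
derivative on the body factor and a contraction on the Grassmann factor. -/
lemma dCoord_cases (p : ℕ) (i : Fin n ⊕ Fin n ⊕ Fin n ⊕ Fin n) :
    (Even (par p i) ∧ ∃ v, dCoord U p i = LinearMap.rTensor (Grassmann n) (dirDeriv v)) ∨
      (Odd (par p i) ∧ ∃ j, dCoord U p i = dOdd j) := by
  by_cases hp : Even p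
  · have hp' : Odd (p + 1) := hp.add_one
    rcases i with i | i | i | i
    · exact Or.inl ⟨by simp [par], _, rfl⟩
    · exact Or.inr ⟨by simp [par], _, rfl⟩
    · exact Or.inr ⟨by simpa [par] using hp', Sum.inr i, by simp [dCoord, dY, hp]⟩
    · exact Or.inl ⟨by simpa [par] using hp, (0, EuclideanSpace.single i 1), if_pos hp⟩
  · have hp' : Even (p + 1) := (Nat.not_even_iff_odd.1 hp).add_one
    rcases i with i | i | i | i
    · exact Or.inl ⟨by simp [par], _, rfl⟩
    · exact Or.inr ⟨by simp [par], _, rfl⟩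
    · exact Or.inl ⟨by simpa [par] using hp', (0, EuclideanSpace.single i 1), if_neg hp⟩
    · exact Or.inr ⟨by simpa [par] using Nat.not_even_iff_odd.1 hp, Sum.inr i, by
        simp [dCoord, dZ, hp]⟩

lemma dCoord_super (p : ℕ) (i : Fin n ⊕ Fin n ⊕ Fin n ⊕ Fin n) :
    IsSuper (parityHom (U := U)) (par p i) (dCoord U p i) := by
  rcases dCoord_cases (U := U) p i with ⟨h, v, e⟩ | ⟨h, j, e⟩
  · rw [e]
    exact (isSuper_rTensor v).congr parityHom_parityHom (by rw [Nat.even_iff] at h; omega)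
  · rw [e]
    exact (isSuper_dOdd j).congr parityHom_parityHom (by rw [Nat.odd_iff] at h; omega)

lemma dCoord_comm (p : ℕ) (i j : Fin n ⊕ Fin n ⊕ Fin n ⊕ Fin n) (f : SuperFun U) :
    dCoord U p i (dCoord U p j f)
      = (-1 : ℝ) ^ (par p i * par p j) • dCoord U p j (dCoord U p i f) := by
  rcases dCoord_cases (U := U) p i with ⟨h, v, e⟩ | ⟨h, k, e⟩
  · rw [(h.mul_right _).neg_one_pow, one_smul, e]
    rcases dCoord_cases (U := U) p j with ⟨h', v', e'⟩ | ⟨h', k', e'⟩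
    · rw [e', rTensor_comm]
    · rw [e', rTensor_dOdd]
  · rcases dCoord_cases (U := U) p j with ⟨h', v', e'⟩ | ⟨h', k', e'⟩
    · rw [(h'.mul_left _).neg_one_pow, one_smul, e, e', rTensor_dOdd]
    · rw [(h.mul h').neg_one_pow, e, e', dOdd_dOdd]
      exact (neg_one_smul ℝ _).symm

lemma cCoord_hom (p : ℕ) (j : Fin n ⊕ Fin n ⊕ Fin n) :
    IsHom (parityHom (U := U)) (par p (Sum.inr j)) (cCoord U p j) := by
  by_cases hp : Even p
  · have hp' := Nat.even_iff.1 hp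
    rcases j with i | i | i <;> simp only [cCoord, cy, cz, hp, Sum.elim_inl, Sum.elim_inr, if_true]
    · exact isHom_oddCoord _
    · exact (isHom_oddCoord _).congr parityHom_parityHom (by simp [par]; omega)
    · exact (isHom_evenCoord _).congr parityHom_parityHom (by simp [par]; omega)
  · have hp' := Nat.odd_iff.1 (Nat.not_even_iff_odd.1 hp)
    rcases j with i | i | i <;> simp only [cCoord, cy, cz, hp, Sum.elim_inl, Sum.elim_inr, if_false]
    · exact isHom_oddCoord _
    · exact (isHom_evenCoord _).congr parityHom_parityHom (by simp [par]; omega)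
    · exact (isHom_oddCoord _).congr parityHom_parityHom (by simp [par]; omega)

lemma dX_evenCoord (i j : Fin n) : dX i (evenCoord j : SuperFun U) = 0 := by
  rw [dX, rTensor_evenCoord]; simp

lemma dEven_evenCoord (i j : Fin n) :
    dEven i (evenCoord j : SuperFun U) = if i = j then 1 else 0 := by
  rw [dEven, rTensor_evenCoord]
  by_cases h : i = j
  · subst h; simp [Algebra.TensorProduct.one_def]
  · simp [h, Ne.symm h]

lemma dOdd_evenCoord (i : Fin n ⊕ Fin n) (j : Fin n) : dOdd i (evenCoord j : SuperFun U) = 0 :=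
  dOdd_ofBody _ _

lemma dX_oddCoord (i : Fin n) (j : Fin n ⊕ Fin n) : dX i (oddCoord j : SuperFun U) = 0 :=
  rTensor_oddCoord _ _

lemma dEven_oddCoord (i : Fin n) (j : Fin n ⊕ Fin n) : dEven i (oddCoord j : SuperFun U) = 0 :=
  rTensor_oddCoord _ _

lemma dCoord_cCoord (p : ℕ) (i : Fin n ⊕ Fin n ⊕ Fin n ⊕ Fin n) (j : Fin n ⊕ Fin n ⊕ Fin n) :
    dCoord U p i (cCoord U p j) = if i = Sum.inr j then 1 else 0 := by
  by_cases hp : Even p <;> rcases i with i | i | i | i <;> rcases j with j | j | j <;>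
    simp [dCoord, cCoord, ca, cy, cz, dA, dY, dZ, hp, dX_evenCoord, dX_oddCoord, dEven_evenCoord,
      dEven_oddCoord, dOdd_evenCoord, dOdd_oddCoord]

lemma dCoord_ofBase (p : ℕ) (j : Fin n ⊕ Fin n ⊕ Fin n) (f : baseFun U) :
    dCoord U p (Sum.inr j) (ofBody (f : BodyFun U)) = 0 := by
  have h : ∀ i, dEven i (ofBody (f : BodyFun U)) = 0 := fun i => by
    rw [dEven, rTensor_ofBody, f.2 i, ofBody, TensorProduct.zero_tmul]
  by_cases hp : Even p <;> rcases j with i | i | i <;>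
    simp [dCoord, dA, dY, dZ, hp, dOdd_ofBody, h]

/-- The graded coordinates on `T*[p]T*[1]U`. -/
def superframe (U : Opens (E n)) (p : ℕ) : Frame n p (SuperFun U) (baseFun U) where
  s := parityHom
  o := (Algebra.TensorProduct.includeLeft : BodyFun U →ₐ[ℝ] SuperFun U).comp (baseFun U).val
  δ := dBase
  X i := ⟨ofBase (fun u => u i) (EuclideanSpace.proj i : E n →L[ℝ] ℝ).contDiff.contDiffOn,
    ofBase_mem _⟩
  ξ := cCoord U p
  d := dCoord U p
  s_s := parityHom_parityHom
  o_hom b := isHom_ofBody _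
  o_inj b hb := Subtype.ext (ofBody_eq_zero hb)
  δ_mul i b c := Subtype.ext (dirDeriv_mul _ _ _)
  δ_X i j := by
    refine Subtype.ext ?_
    ext w
    have h := bX_ofBase_apply (U := U)
      (EuclideanSpace.proj j : E n →L[ℝ] ℝ).contDiff.contDiffOn i w
    refine Eq.trans h ?_
    rw [pd, ContinuousLinearMap.fderiv]
    by_cases hij : i = j
    · subst hij; simp
    · simp [hij, Ne.symm hij]
  ξ_hom := cCoord_hom p
  d_super := dCoord_super p
  d_comm := dCoord_comm p
  dx_o i b := rfl
  dξ_o j b := dCoord_ofBase p j b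
  d_ξ := dCoord_cCoord p

end Superframe

end RPoisson

end

/-! ### Translation to the components in a chart -/

noncomputable section

namespace RPoisson

section Local

variable {n p : ℕ} {U : Opens (E n)}

/-- Evaluation of base functions. -/
def evalAt (w : body U) : baseFun U →ₐ[ℝ] ℝ where
  toFun f := (f : BodyFun U) w
  map_one' := rfl
  map_mul' _ _ := rfl
  map_zero' := rfl
  map_add' _ _ := rfl
  commutes' r := by
    rw [Subalgebra.coe_algebraMap, Algebra.algebraMap_eq_smul_one]
    simp

lemma baseFun_eq_zero_iff {f : baseFun U} : f = 0 ↔ ∀ w, evalAt w f = 0 := by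
  refine ⟨fun h w => by rw [h, map_zero], fun h => Subtype.ext ?_⟩
  ext w
  exact h w

variable (P : (Fin 2 → Fin n) → baseFun U) (R : (Fin (p + 1) → Fin n) → baseFun U)
  (H : (Fin (p + 2) → Fin n) → baseFun U)

lemma QField_eq : QField (fun K => (P K : BodyFun U)) (fun K => (R K : BodyFun U))
    (fun K => (H K : BodyFun U)) = (superframe U p).Q P R H := by
  have hf : ∀ i K, fCoeff (fun K => (P K : BodyFun U)) (fun K => (R K : BodyFun U))
      (fun K => (H K : BodyFun U)) i K
        = (((superframe U p).δ i (R K) + Frame.contr P (fun L => H (Fin.cons i L)) K : baseFun U) :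
          BodyFun U) := by
    intro i K
    simp only [fCoeff, Frame.contr, Subalgebra.coe_add, AddSubmonoidClass.coe_finsetSum,
      Subalgebra.coe_mul, SubmonoidClass.coe_finsetProd]
    rfl
  have hz : ∀ i, Qz (fun K => (P K : BodyFun U)) (fun K => (R K : BodyFun U))
      (fun K => (H K : BodyFun U)) i = (superframe U p).qz P R H i := by
    intro i
    simp only [Qz, hf]
    rfl
  refine LinearMap.ext fun f => ?_
  rw [Frame.Q_apply, QField]
  simp only [LinearMap.sum_apply, LinearMap.add_apply, LinearMap.comp_apply,
    LinearMap.mulLeft_apply, Finset.sum_add_distrib, hz, add_assoc]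
  rfl

lemma euler_eq : euler p = (superframe U p).eu := by
  refine LinearMap.ext fun f => ?_
  rw [Frame.eu, euler]
  simp only [LinearMap.sum_apply, LinearMap.add_apply, LinearMap.comp_apply, LinearMap.smul_apply,
    LinearMap.mulLeft_apply, Finset.sum_add_distrib, Fintype.sum_sum_type, Frame.wt, Sum.elim_inl,
    Sum.elim_inr, one_smul, add_assoc]
  rfl

lemma isHomological_iff : IsHomological p ((superframe U p).Q P R H) ↔
    ∀ f, (superframe U p).Q P R H ((superframe U p).Q P R H f) = 0 := by
  refine ⟨fun h => h.sq_zero, fun h => ⟨fun f g => ?_, fun d f hf => ?_, h⟩⟩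
  · have := ((superframe U p).Q_super P R H).2 f g
    rwa [pow_one] at this
  · unfold HasDegree at *
    rw [euler_eq] at *
    have := Frame.deg_Q (superframe U p) (P := P) (R := R) (H := H) (r := d) hf
    rw [Int.cast_add, Int.cast_one]
    exact this

end Local

section Chart

variable {n p : ℕ} {M : Type*} [TopologicalSpace M] [ChartedSpace (E n) M]

/-- The components of a multivector field in a chart, as base functions. -/
def MultivectorField.baseCoeff {q : ℕ} (T : MultivectorField n M q)
    {e : OpenPartialHomeomorph M (E n)} (he : e ∈ IsManifold.maximalAtlas (𝓡 n) ∞ M)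
    (K : Fin q → Fin n) : baseFun (dom e) :=
  ⟨T.coeff he K, ofBase_mem _⟩

/-- The components of a differential form in a chart, as base functions. -/
def FormField.baseCoeff {q : ℕ} (η : FormField n M q)
    {e : OpenPartialHomeomorph M (E n)} (he : e ∈ IsManifold.maximalAtlas (𝓡 n) ∞ M)
    (L : Fin q → Fin n) : baseFun (dom e) :=
  ⟨η.coeff he L, ofBase_mem _⟩

lemma sign_smul_eq {q : ℕ} (σ : Equiv.Perm (Fin q)) (x : ℝ) :
    Equiv.Perm.sign σ • x = ((Equiv.Perm.sign σ : ℤ) : ℝ) * x := by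
  rcases Int.units_eq_one_or (Equiv.Perm.sign σ) with h | h <;> simp [h]

lemma MultivectorField.comp_perm {q : ℕ} (T : MultivectorField n M q)
    (e : OpenPartialHomeomorph M (E n)) (K : Fin q → Fin n) (σ : Equiv.Perm (Fin q)) (u : E n) :
    T.comp e (fun r => K (σ r)) u = ((Equiv.Perm.sign σ : ℤ) : ℝ) * T.comp e K u := by
  rw [← sign_smul_eq]
  exact (T.toFun (e.symm u)).toAlternatingMap.map_perm (fun r => dcoord e (K r) (e.symm u)) σ

lemma FormField.comp_perm {q : ℕ} (η : FormField n M q)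
    (e : OpenPartialHomeomorph M (E n)) (K : Fin q → Fin n) (σ : Equiv.Perm (Fin q)) (u : E n) :
    η.comp e (fun r => K (σ r)) u = ((Equiv.Perm.sign σ : ℤ) : ℝ) * η.comp e K u := by
  rw [← sign_smul_eq]
  exact (formInChart η.toFun e u).toAlternatingMap.map_perm
    (fun r => EuclideanSpace.single (K r) (1 : ℝ)) σ

variable {e : OpenPartialHomeomorph M (E n)} (he : e ∈ IsManifold.maximalAtlas (𝓡 n) ∞ M)

lemma evalAt_baseCoeff {q : ℕ} (T : MultivectorField n M q) (K : Fin q → Fin n)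
    (w : body (dom e)) : evalAt w (T.baseCoeff he K) = T.comp e K (w : E n × E n).1 := rfl

lemma evalAt_form_baseCoeff {q : ℕ} (η : FormField n M q) (K : Fin q → Fin n)
    (w : body (dom e)) : evalAt w (η.baseCoeff he K) = η.comp e K (w : E n × E n).1 := rfl

lemma evalAt_dBase {q : ℕ} (T : MultivectorField n M q) (K : Fin q → Fin n) (i : Fin n)
    (w : body (dom e)) :
    evalAt w ((superframe (dom e) p).δ i (T.baseCoeff he K))
      = pd i (T.comp e K) (w : E n × E n).1 :=
  bX_ofBase_apply (T.smooth e he K) i w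

lemma evalAt_form_dBase {q : ℕ} (η : FormField n M q) (K : Fin q → Fin n) (i : Fin n)
    (w : body (dom e)) :
    evalAt w ((superframe (dom e) p).δ i (η.baseCoeff he K))
      = pd i (η.comp e K) (w : E n × E n).1 :=
  bX_ofBase_apply (η.contDiffOn_comp he K) i w

lemma MultivectorField.alt_baseCoeff {q : ℕ} (T : MultivectorField n M q) :
    Alt (T.baseCoeff he) := by
  intro K σ
  rw [← sub_eq_zero, baseFun_eq_zero_iff]
  intro w
  rw [map_sub, map_mul, map_intCast, evalAt_baseCoeff, evalAt_baseCoeff, T.comp_perm, sub_self]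

lemma FormField.alt_baseCoeff {q : ℕ} (η : FormField n M q) : Alt (η.baseCoeff he) := by
  intro K σ
  rw [← sub_eq_zero, baseFun_eq_zero_iff]
  intro w
  rw [map_sub, map_mul, map_intCast, evalAt_form_baseCoeff, evalAt_form_baseCoeff, η.comp_perm,
    sub_self]

lemma evalAt_sch {q : ℕ} (P : MultivectorField n M 2) (T : MultivectorField n M (q + 1))
    (K : Fin (q + 2) → Fin n) (w : body (dom e)) :
    evalAt w ((superframe (dom e) p).sch (P.baseCoeff he) (T.baseCoeff he) K)
      = schouten P T e K (w : E n × E n).1 := by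
  simp only [Frame.sch, Frame.schTerm, map_sum, map_mul, map_sub, map_smul, map_intCast,
    evalAt_baseCoeff, evalAt_dBase, smul_eq_mul, schouten]

/-- The sign collects one transposition of indices from each of the q factors P. -/
lemma evalAt_contr {q : ℕ} (P : MultivectorField n M 2) (η : FormField n M q)
    (K : Fin q → Fin n) (w : body (dom e)) :
    evalAt w (Frame.contr (P.baseCoeff he) (η.baseCoeff he) K)
      = (-1) ^ q * contraction P η e K (w : E n × E n).1 := by
  simp only [Frame.contr, map_sum, map_mul, map_prod, evalAt_baseCoeff, evalAt_form_baseCoeff,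
    contraction, Finset.mul_sum]
  refine Finset.sum_congr rfl fun L _ => ?_
  rw [← mul_assoc]
  congr 1
  have h : ∀ r, P.comp e ![K r, L r] (w : E n × E n).1
      = -1 * P.comp e ![L r, K r] (w : E n × E n).1 := by
    intro r
    have := congrArg (evalAt w) ((P.alt_baseCoeff he).pair (K r) (L r))
    rwa [map_neg, evalAt_baseCoeff, evalAt_baseCoeff, ← neg_one_mul] at this
  simp only [h, Finset.prod_mul_distrib]
  simp

lemma closed_baseCoeff {q : ℕ} {η : FormField n M q} (hη : η.IsClosed) :
    (superframe (dom e) p).Closed (η.baseCoeff he) := by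
  intro K
  rw [baseFun_eq_zero_iff]
  intro w
  simp only [map_sum, map_mul, map_pow, map_neg, map_one, evalAt_form_dBase]
  have hd : DifferentiableAt ℝ (formInChart η.toFun e) (w : E n × E n).1 :=
    ((η.smooth e he).contDiffAt (e.open_target.mem_nhds w.2.1)).differentiableAt (by simp)
  have h := congrArg (fun α => α fun r => EuclideanSpace.single (K r) (1 : ℝ))
    (hη e he _ w.2.1)
  beta_reduce at h
  rw [extDeriv_apply hd] at h
  refine Eq.trans (Finset.sum_congr rfl fun r _ => ?_) h
  rw [zsmul_eq_mul]
  push_cast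
  congr 1

lemma isHomological_QField_iff {p : ℕ} (P : MultivectorField n M 2)
    (R : MultivectorField n M (p + 1)) (H : FormField n M (p + 2)) (hH : H.IsClosed) :
    IsHomological p (QField (P.coeff he) (R.coeff he) (H.coeff he)) ↔
      (∀ u ∈ e.target, ∀ K : Fin 3 → Fin n, schouten (q := 1) P P e K u = 0) ∧
      ∀ u ∈ e.target, ∀ K : Fin (p + 2) → Fin n,
        schouten P R e K u = (-1) ^ (p + 1) * contraction P H e K u := by
  have hsign : ∀ a b : ℝ, a + (-1) ^ (p + 2) * b = 0 ↔ a = (-1) ^ (p + 1) * b := by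
    intro a b
    rw [pow_succ _ (p + 1), mul_neg_one, neg_mul, ← sub_eq_add_neg, sub_eq_zero]
  have h1 := isHomological_iff (P.baseCoeff he) (R.baseCoeff he) (H.baseCoeff he)
  rw [← QField_eq, QField_eq, Frame.Q_sq_eq_zero_iff _ (P.alt_baseCoeff he) (R.alt_baseCoeff he)
    (H.alt_baseCoeff he) (closed_baseCoeff he hH), ← QField_eq] at h1
  refine h1.trans (and_congr ?_ ?_)
  · simp only [baseFun_eq_zero_iff, evalAt_sch]
    -- Base functions are tested at the points of the zero section over the chart.
    exact ⟨fun h u hu K => h K ⟨(u, 0), hu, trivial⟩, fun h K w => h _ w.2.1 K⟩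
  · simp only [baseFun_eq_zero_iff, map_add, evalAt_sch, evalAt_contr, hsign]
    exact ⟨fun h u hu K => h K ⟨(u, 0), hu, trivial⟩, fun h K w => h _ w.2.1 K⟩

end Chart

end RPoisson

end

theorem proposition4p1 {n p : ℕ} (hp : 1 ≤ p)
    {M : Type*} [TopologicalSpace M] [ChartedSpace (RPoisson.E n) M]
    [IsManifold (𝓡 n) ∞ M]
    (P : RPoisson.MultivectorField n M 2) (R : RPoisson.MultivectorField n M (p + 1))
    (H : RPoisson.FormField n M (p + 2)) (hH : H.IsClosed) :
    RPoisson.IsQManifold P R H ↔ RPoisson.IsTwistedRPoisson P R H := by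
  constructor
  · intro h
    have key := fun e he => (RPoisson.isHomological_QField_iff he P R H hH).1 (h e he)
    exact ⟨fun e he => (key e he).1, hH, fun e he => (key e he).2⟩
  · intro h e he
    exact (RPoisson.isHomological_QField_iff he P R H hH).2 ⟨h.poisson e he, h.bracket e he⟩
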